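/- Let $n\ge 2$, let $e_{ij}$ be the matrix units of size $n$, $b=\sum_{i=1}^{n-1}e_{i+1,i}$, $J=e_{1n}\lambda+b$, $V_n=\bigoplus_{i=1}^{n-1}\mathbb{R}e_{in}$, $V_n^t=\bigoplus_{i=1}^{n-1}\mathbb{R}e_{ni}$, $\pi_0(y)=\sum_{i=1}^{n-1}y_{ni}e_{ni}$, let $S^1=\mathbb{R}/2\pi\mathbb{Z}$, and $\langle y_1,y_2\rangle=\oint \mathrm{tr}(y_1(x)y_2(x))\,dx$. The gradient at $u$ of a functional $F$ on $C^\infty(S^1,V_n)$ is the element $\nabla F(u)\in C^\infty(S^1,V_n^t)$ with $dF_u(v)=\langle\nabla F(u),v\rangle$ for all $v\in C^\infty(S^1,V_n)$, where $dF_u(v)=\frac{d}{ds}\big|_{s=0}F(u+sv)$. For $u\in C^\infty(S^1,V_n)$ the following objects are well defined. 1. There are a unique series $T=\sum_{i\ge0}T_i\lambda^{-i}$, with $T_i$ smooth matrix-valued functions on $S^1$, and unique $f_i(u)\in C^\infty(S^1,\mathbb{R})$, such that $T_0$ is upper triangular with ones on the diagonal, the first column of $T$ is $(1,0,\dots,0)^t$,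 and $$T(\partial_x+J+u)T^{-1}=\partial_x+J+\sum_{i\ge 0}f_i(u)J^{-i}.$$ Put $H_i(u)=n\oint f_i(u)\,dx$. 2. For $v\in C^\infty(S^1,V_n^t)$ there is a unique $P_u(v)=C\in C^\infty(S^1,sl(n,\mathbb{R}))$ with $\pi_0(C)=v$ and $C_x+[b+u,C]\in C^\infty(S^1,V_n)$. 3. For $\xi\in C^\infty(S^1,V_n^t)$ there is a unique $(J_1)_u(\xi)\in C^\infty(S^1,V_n)$ with $\langle (J_1)_u(\xi),\eta\rangle=\langle[e_{1n},P_u(\xi)],P_u(\eta)\rangle$ for all $\eta\in C^\infty(S^1,V_n^t)$. This $(J_1)_u$ is the Poisson operator of the first Poisson structure $\{F_1,F_2\}_1(u)=\langle[e_{1n},P_u(\nabla F_1(u))],P_u(\nabla F_2(u))\rangle$. 4. For $1\le j\le n-1$ the functional $H_j$ has a unique gradient $\nabla H_j(u)$. **Theorem.** For every $u\in C^\infty(S^1,V_n)$ and $1\le j\le n-1$ we have $(J_1)_u(\nabla H_j(u))=0$. In other words, $H_1,\dots,H_{n-1}$ are Casimirs of $\{\,,\}_1$: $\{H_j,F\}_1(u)=0$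 for every $u$ and every functional $F$ that has a gradient at $u$. Moreover, for every $u$, $\mathrm{Ker}((J_1)_u)$ is equal to the real span of $\{\nabla H_1(u),\dots,\nabla H_{n-1}(u)\}$. -/

import Mathlib

open scoped ContDiff PowerSeries LaurentSeries Matrix

noncomputable section

namespace DSKdV

/-- The real algebra `C^∞(S¹, ℝ)`, as the algebra of smooth `2π`-periodic functions on `ℝ`. -/
def LoopRing : Subalgebra ℝ (ℝ → ℝ) where
  carrier := {f | ContDiff ℝ ∞ f ∧ Function.Periodic f (2 * Real.pi)}
  mul_mem' := fun hf hg => ⟨hf.1.mul hg.1, hf.2.mul hg.2⟩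
  add_mem' := fun hf hg => ⟨hf.1.add hg.1, hf.2.add hg.2⟩
  algebraMap_mem' := fun _ => ⟨contDiff_const, fun _ => rfl⟩

/-- `∂_x` on `C^∞(S¹, ℝ)`. -/
def dx : Derivation ℝ LoopRing LoopRing :=
  Derivation.mk'
    { toFun := fun f => ⟨deriv f.1, (contDiff_infty_iff_deriv.1 f.2.1).2, fun x => by
        rw [← deriv_comp_add_const]
        exact congrArg (fun g => deriv g x) (funext f.2.2)⟩
      map_add' := fun f g => Subtype.ext <| funext fun x =>
        deriv_add (f.2.1.differentiable (by simp) x) (g.2.1.differentiable (by simp) x)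
      map_smul' := fun c f => Subtype.ext <| funext fun x =>
        deriv_const_smul c (f.2.1.differentiable (by simp) x) }
    (fun f g => Subtype.ext <| funext fun x => by
      have h := deriv_mul (f.2.1.differentiable (by simp) x) (g.2.1.differentiable (by simp) x)
      change deriv (f.1 * g.1) x = f.1 x * deriv g.1 x + g.1 x * deriv f.1 x
      rw [h]; ring)

/-- The integral over the circle. -/
def circInt (f : LoopRing) : ℝ := ∫ x in (0 : ℝ)..(2 * Real.pi), f.1 x

/-- `C^∞(S¹, gl(n,ℝ))`: matrices whose entries are smooth periodic functions
(matrix multiplication is the pointwise one). -/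
abbrev LoopMat (n : ℕ) : Type := Matrix (Fin n) (Fin n) LoopRing

/-- The bilinear form `⟨y₁, y₂⟩ = ∮ tr(y₁(x) y₂(x)) dx`. -/
def pairing {n : ℕ} (y₁ y₂ : LoopMat n) : ℝ := circInt (y₁ * y₂).trace

/-- The matrix `b = ∑_{i=1}^{n-1} e_{i+1,i}`. -/
def bMat (n : ℕ) (A : Type*) [Zero A] [One A] : Matrix (Fin n) (Fin n) A :=
  Matrix.of fun i j => if i.val = j.val + 1 then 1 else 0

/-- The matrix `e_{1n}`. -/
def e1n (n : ℕ) (A : Type*) [Zero A] [One A] : Matrix (Fin n) (Fin n) A :=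
  Matrix.of fun i j => if i.val = 0 ∧ j.val + 1 = n then 1 else 0

/-- `C^∞(S¹, V_n)`, where `V_n` is spanned by `e_{in}`, `1 ≤ i ≤ n-1`. -/
def VLoop (n : ℕ) : Submodule ℝ (LoopMat n) where
  carrier := {y | ∀ i j : Fin n, ¬ (i.val + 1 < n ∧ j.val + 1 = n) → y i j = 0}
  add_mem' := fun hy hz i j h => by simp [hy i j h, hz i j h]
  zero_mem' := fun _ _ _ => rfl
  smul_mem' := fun c y hy i j h => by simp [hy i j h]

/-- `C^∞(S¹, V_n^t)`, where `V_n^t` is spanned by `e_{ni}`, `1 ≤ i ≤ n-1`. -/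
def VtLoop (n : ℕ) : Submodule ℝ (LoopMat n) where
  carrier := {y | ∀ i j : Fin n, ¬ (i.val + 1 = n ∧ j.val + 1 < n) → y i j = 0}
  add_mem' := fun hy hz i j h => by simp [hy i j h, hz i j h]
  zero_mem' := fun _ _ _ => rfl
  smul_mem' := fun c y hy i j h => by simp [hy i j h]

/-- The canonical projection `π₀(y) = ∑_{i=1}^{n-1} y_{ni} e_{ni}`. -/
def piZero {n : ℕ} (y : LoopMat n) : LoopMat n :=
  Matrix.of fun i j => if i.val + 1 = n ∧ j.val + 1 < n then y i j else 0

/-- The commutator `[∂_x + b + u, C] = C_x + [b + u, C]`. -/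
def covDeriv {n : ℕ} (u C : LoopMat n) : LoopMat n :=
  C.map dx + ((bMat n LoopRing + u) * C - C * (bMat n LoopRing + u))

/-- The defining property of `C = P_u(v)`: `C` has trace zero, `π₀(C) = v` and
`[∂_x + b + u, C]` takes values in `V_n`. -/
def IsP {n : ℕ} (u : VLoop n) (v : VtLoop n) (C : LoopMat n) : Prop :=
  C.trace = 0 ∧ piZero C = v.1 ∧ covDeriv u.1 C ∈ VLoop n

/-- The operator `P_u`. -/
def P {n : ℕ} (u : VLoop n) (v : VtLoop n) : LoopMat n :=
  Classical.epsilon fun C => IsP u v C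

/-- `ξ` is the gradient at `u` of the functional `F` on `C^∞(S¹, V_n)`:
`dF_u(v) = ⟨ξ, v⟩` for every `v`. -/
def IsGradient {n : ℕ} (F : VLoop n → ℝ) (u : VLoop n) (ξ : VtLoop n) : Prop :=
  ∀ v : VLoop n, HasDerivAt (fun s : ℝ => F (u + s • v)) (pairing ξ.1 v.1) 0

/-- The gradient `∇F(u)`. -/
def gradient {n : ℕ} (F : VLoop n → ℝ) (u : VLoop n) : VtLoop n :=
  Classical.epsilon fun ξ => IsGradient F u ξ

/-- The bilinear form `(ξ, η) ↦ ⟨[e_{1n}, P_u(ξ)], P_u(η)⟩`. -/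
def form₁ {n : ℕ} (u : VLoop n) (ξ η : VtLoop n) : ℝ :=
  pairing (e1n n LoopRing * P u ξ - P u ξ * e1n n LoopRing) (P u η)

/-- The first Poisson structure `{F₁, F₂}₁(u) = ⟨[e_{1n}, P_u(∇F₁(u))], P_u(∇F₂(u))⟩`. -/
def bracket₁ {n : ℕ} (F₁ F₂ : VLoop n → ℝ) (u : VLoop n) : ℝ :=
  form₁ u (gradient F₁ u) (gradient F₂ u)

/-- The defining property of `w = (J₁)_u(ξ)`. -/
def IsJ₁ {n : ℕ} (u : VLoop n) (ξ : VtLoop n) (w : VLoop n) : Prop :=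
  ∀ η : VtLoop n, pairing w.1 η.1 = form₁ u ξ η

/-- The Poisson operator `(J₁)_u : C^∞(S¹, V_n^t) → C^∞(S¹, V_n)`. -/
def J₁ {n : ℕ} (u : VLoop n) (ξ : VtLoop n) : VLoop n :=
  Classical.epsilon fun w => IsJ₁ u ξ w

/-- `H` is a Casimir of `{ , }₁`: its bracket with every functional vanishes. -/
def IsCasimir₁ {n : ℕ} (H : VLoop n → ℝ) : Prop :=
  ∀ (F : VLoop n → ℝ) (u : VLoop n), (∃ η, IsGradient F u η) → bracket₁ H F u = 0

/-! Formal series in `λ⁻¹`. The variable of the power and Laurent series below is `λ⁻¹`, so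
that `λ` is the Laurent series `HahnSeries.single (-1) 1`. -/

/-- `J = e_{1n} λ + b`. -/
def JMat (n : ℕ) (R : Type*) [CommRing R] : Matrix (Fin n) (Fin n) R⸨X⸩ :=
  (HahnSeries.single (-1 : ℤ) (1 : R) : R⸨X⸩) • e1n n R⸨X⸩ + bMat n R⸨X⸩

/-- `J⁻¹ = bᵗ + e_{n1} λ⁻¹`, see `JMat_mul_JInv`. -/
def JInv (n : ℕ) (R : Type*) [CommRing R] : Matrix (Fin n) (Fin n) R⟦X⟧ :=
  (bMat n R⟦X⟧)ᵀ + (PowerSeries.X : R⟦X⟧) • (e1n n R⟦X⟧)ᵀ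

/-- A matrix of power series in `λ⁻¹` as a matrix of Laurent series. -/
def toLaurent {n : ℕ} {R : Type*} [CommRing R] (T : Matrix (Fin n) (Fin n) R⟦X⟧) :
    Matrix (Fin n) (Fin n) R⸨X⸩ :=
  T.map (HahnSeries.ofPowerSeries ℤ R)

theorem shift_mul_shift {A : Type*} [CommRing A] (n : ℕ) (l x : A) (h : l * x = 1) :
    (l • e1n n A + bMat n A) * ((bMat n A)ᵀ + x • (e1n n A)ᵀ) = 1 := by
  have hL : ∀ i k : Fin n, (l • e1n n A + bMat n A) i k =
      (if i.val = 0 ∧ k.val + 1 = n then l else 0) + (if i.val = k.val + 1 then 1 else 0) := by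
    intro i k
    simp [e1n, bMat]
  have hK : ∀ k j : Fin n, ((bMat n A)ᵀ + x • (e1n n A)ᵀ) k j =
      (if j.val = k.val + 1 then 1 else 0) + (if j.val = 0 ∧ k.val + 1 = n then x else 0) := by
    intro i k
    simp [e1n, bMat]
  ext i j : 1
  rw [Matrix.mul_apply, Matrix.one_apply]
  simp only [hL, hK]
  obtain ⟨i, hi⟩ := i
  obtain ⟨j, hj⟩ := j
  rcases i with _ | i
  · rw [Finset.sum_eq_single ⟨n - 1, by omega⟩]
    · have h1 : n - 1 + 1 = n := by omega
      have h2 : (0 : ℕ) ≠ n := by omega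
      rcases j with _ | j
      · simp [h1, h2, h]
      · have h4 : j + 1 ≠ n := by omega
        simp [h1, h2, h4]
    · rintro ⟨k, hk⟩ - h
      have h1 : k + 1 ≠ n := fun h' => h (Fin.ext (by simp; omega))
      simp [h1]
    · simp
  · rw [Finset.sum_eq_single ⟨i, by omega⟩]
    · have h1 : i + 1 ≠ n := by omega
      by_cases h : i = j
      · subst h; simp [h1]
      by_cases h' : i + 1 = j
      · subst h'; simp [h1]
      · have : j ≠ i + 1 := fun h => h' h.symm
        simp [h1, h', this]
    · rintro ⟨k, hk⟩ - h
      have h1 : i ≠ k := fun h' => h (Fin.ext h'.symm)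
      simp [h1]
    · simp

theorem JMat_mul_JInv (n : ℕ) (R : Type*) [CommRing R] : JMat n R * toLaurent (JInv n R) = 1 := by
  have hX : (HahnSeries.single (-1 : ℤ) (1 : R) : R⸨X⸩) *
      HahnSeries.single (1 : ℤ) (1 : R) = 1 := by
    rw [HahnSeries.single_mul_single]; simp
  have hK : toLaurent (JInv n R) = (bMat n R⸨X⸩)ᵀ +
      (HahnSeries.single (1 : ℤ) (1 : R) : R⸨X⸩) • (e1n n R⸨X⸩)ᵀ := by
    ext i j : 1
    simp only [toLaurent, JInv, bMat, e1n, Matrix.map_apply, Matrix.add_apply,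
      Matrix.smul_apply, Matrix.transpose_apply, Matrix.of_apply, smul_eq_mul, map_add, map_mul,
      apply_ite (HahnSeries.ofPowerSeries ℤ R), map_one, map_zero,
      HahnSeries.ofPowerSeries_X]
  rw [hK]
  exact shift_mul_shift n _ _ hX

theorem coeff_JInv_pow {R : Type*} [CommRing R] (n i k : ℕ) (a c : Fin n)
    (h : PowerSeries.coeff k ((JInv n R ^ i) a c) ≠ 0) : a.val + i = c.val + n * k := by
  induction i generalizing k c with
  | zero =>
    rw [pow_zero, Matrix.one_apply] at h
    split_ifs at h with hac
    · rw [PowerSeries.coeff_one] at h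
      split_ifs at h with hk
      · subst hac hk; simp
      · exact absurd rfl h
    · simp at h
  | succ i ih =>
    have hK : ∀ m : Fin n, JInv n R m c = (if c.val = m.val + 1 then 1 else 0) +
        (if c.val = 0 ∧ m.val + 1 = n then PowerSeries.X else 0) := by
      intro m
      simp [JInv, e1n, bMat]
    rw [pow_succ, Matrix.mul_apply, map_sum] at h
    obtain ⟨m, -, hm⟩ := Finset.exists_ne_zero_of_sum_ne_zero h
    rw [hK m] at hm
    by_cases h1 : c.val = m.val + 1
    · have h2 : ¬ (c.val = 0 ∧ m.val + 1 = n) := by omega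
      rw [if_pos h1, if_neg h2, add_zero, mul_one] at hm
      have := ih k m hm
      omega
    · by_cases h2 : c.val = 0 ∧ m.val + 1 = n
      · rw [if_neg h1, if_pos h2, zero_add] at hm
        rcases k with _ | k
        · rw [PowerSeries.coeff_zero_mul_X] at hm
          exact absurd rfl hm
        · rw [PowerSeries.coeff_succ_mul_X] at hm
          have := ih k m hm
          rw [Nat.mul_add]
          omega
      · rw [if_neg h1, if_neg h2, add_zero, mul_zero, map_zero] at hm
        exact absurd rfl hm

/-- The series `∑_{i ≥ 0} f_i J^{-i}`; for each power of `λ` only finitely many `i` contribute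
to its coefficient, by `coeff_JInv_pow`. -/
def JSeries {n : ℕ} {R : Type*} [CommRing R] (f : ℕ → R) : Matrix (Fin n) (Fin n) R⟦X⟧ :=
  Matrix.of fun a c => PowerSeries.mk fun k =>
    ∑ᶠ i : ℕ, f i * PowerSeries.coeff k ((JInv n R ^ i) a c)

/-- `∂_x` applied to the coefficients of a matrix of Laurent series. -/
def dxLaurent {n : ℕ} (S : Matrix (Fin n) (Fin n) LoopRing⸨X⸩) :
    Matrix (Fin n) (Fin n) LoopRing⸨X⸩ :=
  S.map fun s => HahnSeries.map s dx

/-- `T = ∑_{i ≥ 0} T_i λ^{-i}` and `f` satisfy: `T_0` is upper triangular with ones on the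
diagonal, the first column of `T` is `e_1`, and
`T (∂_x + J + u) T⁻¹ = ∂_x + J + ∑_{i ≥ 0} f_i J^{-i}`. -/
def IsDressing {n : ℕ} (u : VLoop n) (T : Matrix (Fin n) (Fin n) LoopRing⟦X⟧)
    (f : ℕ → LoopRing) : Prop :=
  (∀ i j : Fin n, j < i → PowerSeries.coeff 0 (T i j) = 0) ∧
  (∀ i : Fin n, PowerSeries.coeff 0 (T i i) = 1) ∧
  (∀ i j : Fin n, j.val = 0 → T i j = if i.val = 0 then 1 else 0) ∧
  toLaurent T * (JMat n LoopRing + u.1.map HahnSeries.C) * (toLaurent T)⁻¹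
      - dxLaurent (toLaurent T) * (toLaurent T)⁻¹
    = JMat n LoopRing + toLaurent (JSeries f)

/-- The densities `f_i(u)`. -/
def density {n : ℕ} (u : VLoop n) : ℕ → LoopRing :=
  (Classical.epsilon fun p : Matrix (Fin n) (Fin n) LoopRing⟦X⟧ × (ℕ → LoopRing) =>
    IsDressing u p.1 p.2).2

/-- The conserved functionals `H_i(u) = n ∮ f_i(u) dx`. -/
def H (n : ℕ) (i : ℕ) (u : VLoop n) : ℝ := n * circInt (density u i)

end DSKdV

end

open scoped ContDiff PowerSeries LaurentSeries Matrix

noncomputable section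

namespace DSKdV

/-! The last row of `C = P_u(ξ)` off the corner is `ξ`. Since `[∂ + b + u, C]` lives in the last
column, each column of `C` is `∂ + b + u` applied to the previous one. So `C` is determined by its
first column, and prescribing the last row and the trace gives a triangular system for that column
(`existsUnique_isP`).

Replacing `u` by `u + λ e_{1n}` makes `P` affine in `λ`, with strictly upper triangular linear part
`linP`. The coefficient `W` of `λ` in the resulting commutator lies in `V_n` and represents the
bilinear form, so it is `(J₁)_u(ξ)` (`pairing_W`, `J₁_eq`). This makes the Poisson operator
explicit. If `ξ` starts at position `m`, one entry of `W` is `n ∂ξ_m`; hence the first nonzero entry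
of a kernel element is constant (`dx_ent_eq_zero_of_J₁_eq_zero`).

For the dressing, write column `c` of `T` as `p_c(J⁻¹) e_c`. The equation becomes `p_{c+1} = J⁻¹
∂p_c + (1 + J⁻¹ f) p_c`, and the last column gives a scalar Riccati equation, solvable uniquely
order by order (`isDressing_iff`, `existsUnique_riccati`). Varying `u` and taking the trace against
`J^{-(n-j)}` shows that `∇H_j` is `π₀` of the `λ⁻¹` coefficient `R_1` of `R = T⁻¹ J^{-(n-j)} T`
(`isGradient_gradH`). As `R` commutes with `∂ + J + u`, its coefficients satisfy `[∂ + b + u, R_k] =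
-[e_{1n}, R_{k+1}]`. Two integrations by parts, with the vanishing of the last row of `R_0`, give
the Casimir property (`form₁_gradH`).

Finally, the last rows of the gradients are in echelon form with leading entries `1` (`ent_gradH`).
Subtracting real multiples of them removes the constant leading entries of a kernel element one at a
time, which gives the span (`mem_span_gradH`). -/

/-! ### The circle integral, the trace pairing and its nondegeneracy. -/

theorem continuous_coe (f : LoopRing) : Continuous f.1 := f.2.1.continuous

/-- The integral over the circle, as a linear functional. -/
def circIntLinear : LoopRing →ₗ[ℝ] ℝ where
  toFun := circInt
  map_add' f g := intervalIntegral.integral_add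
    ((continuous_coe f).intervalIntegrable _ _) ((continuous_coe g).intervalIntegrable _ _)
  map_smul' c f := intervalIntegral.integral_const_mul c f.1

theorem circInt_add (f g : LoopRing) : circInt (f + g) = circInt f + circInt g :=
  circIntLinear.map_add f g

theorem circInt_sub (f g : LoopRing) : circInt (f - g) = circInt f - circInt g :=
  circIntLinear.map_sub f g

theorem circInt_neg (f : LoopRing) : circInt (-f) = -circInt f :=
  circIntLinear.map_neg f

theorem circInt_smul (c : ℝ) (f : LoopRing) : circInt (c • f) = c * circInt f :=
  circIntLinear.map_smul c f

theorem circInt_zero : circInt 0 = 0 := circIntLinear.map_zero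

theorem circInt_sum {ι : Type*} (s : Finset ι) (f : ι → LoopRing) :
    circInt (∑ i ∈ s, f i) = ∑ i ∈ s, circInt (f i) :=
  map_sum circIntLinear f s

theorem circInt_dx (f : LoopRing) : circInt (dx f) = 0 := by
  have h := intervalIntegral.integral_deriv_eq_sub (f := f.1) (a := 0) (b := 2 * Real.pi)
    (fun x _ => f.2.1.differentiable (by simp) x)
    ((continuous_coe (dx f)).intervalIntegrable _ _)
  refine h.trans ?_
  rw [f.2.2.eq, sub_self]

theorem circInt_mul_self_nonneg (f : LoopRing) : 0 ≤ circInt (f * f) :=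
  intervalIntegral.integral_nonneg (by positivity) fun x _ => mul_self_nonneg (f.1 x)

theorem eq_zero_of_circInt_mul_self (f : LoopRing) (h : circInt (f * f) = 0) : f = 0 := by
  by_contra hf
  obtain ⟨x, hx⟩ : ∃ x, f.1 x ≠ 0 := by
    by_contra! h0
    exact hf (Subtype.ext (funext h0))
  have hp : (0 : ℝ) < 2 * Real.pi := by positivity
  obtain ⟨y, hy, hxy⟩ := f.2.2.exists_mem_Ico₀ hp x
  have : 0 < circInt (f * f) := by
    refine intervalIntegral.integral_pos hp (continuous_coe (f * f)).continuousOn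
      (fun x _ => mul_self_nonneg (f.1 x)) ⟨y, ⟨hy.1, hy.2.le⟩, ?_⟩
    exact mul_self_pos.2 (hxy ▸ hx)
  exact this.ne' h

theorem exists_algebraMap_of_dx_eq_zero (f : LoopRing) (h : dx f = 0) :
    ∃ r : ℝ, f = algebraMap ℝ LoopRing r := by
  refine ⟨f.1 0, Subtype.ext (funext fun x => ?_)⟩
  exact is_const_of_deriv_eq_zero (f.2.1.differentiable (by simp))
    (fun y => congrFun (congrArg Subtype.val h) y) x 0

variable {n : ℕ}

theorem pairing_comm (y z : LoopMat n) : pairing y z = pairing z y := by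
  rw [pairing, pairing, Matrix.trace_mul_comm]

theorem pairing_add_left (x y z : LoopMat n) :
    pairing (x + y) z = pairing x z + pairing y z := by
  rw [pairing, add_mul, Matrix.trace_add, circInt_add]; rfl

theorem pairing_sub_left (x y z : LoopMat n) :
    pairing (x - y) z = pairing x z - pairing y z := by
  rw [pairing, sub_mul, Matrix.trace_sub, circInt_sub]; rfl

theorem pairing_neg_left (y z : LoopMat n) : pairing (-y) z = -pairing y z := by
  rw [pairing, Matrix.neg_mul, Matrix.trace_neg, circInt_neg]; rfl

theorem pairing_smul_left (c : ℝ) (y z : LoopMat n) : pairing (c • y) z = c * pairing y z := by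
  rw [pairing, Matrix.smul_mul, Matrix.trace_smul, circInt_smul]; rfl

theorem pairing_zero_left (z : LoopMat n) : pairing 0 z = 0 := by
  rw [pairing, zero_mul, Matrix.trace_zero, circInt_zero]

theorem pairing_eq_sum (y z : LoopMat n) :
    pairing y z = ∑ i, ∑ j, circInt (y i j * z j i) := by
  rw [pairing, Matrix.trace, circInt_sum]
  refine Finset.sum_congr rfl fun i _ => ?_
  rw [Matrix.diag_apply, Matrix.mul_apply, circInt_sum]

/-- Pairing with the transpose gives the sum of the squared `L²` norms of the entries. Since
transposition exchanges `V_n` and `V_n^t`, this yields nondegeneracy between them. -/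
theorem eq_zero_of_pairing_transpose (y : LoopMat n) (h : pairing y yᵀ = 0) : y = 0 := by
  rw [pairing_eq_sum] at h
  have h0 : ∀ i j, 0 ≤ circInt (y i j * yᵀ j i) := fun i j => circInt_mul_self_nonneg _
  have h1 := (Finset.sum_eq_zero_iff_of_nonneg
    fun i _ => Finset.sum_nonneg fun j _ => h0 i j).1 h
  ext1 i j
  have h2 := (Finset.sum_eq_zero_iff_of_nonneg fun j _ => h0 i j).1 (h1 i (Finset.mem_univ _))
  exact eq_zero_of_circInt_mul_self _ (h2 j (Finset.mem_univ _))

theorem transpose_mem_VtLoop {y : LoopMat n} (h : y ∈ VLoop n) : yᵀ ∈ VtLoop n :=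
  fun i j hij => h j i fun h' => hij ⟨h'.2, h'.1⟩

theorem transpose_mem_VLoop {y : LoopMat n} (h : y ∈ VtLoop n) : yᵀ ∈ VLoop n :=
  fun i j hij => h j i fun h' => hij ⟨h'.2, h'.1⟩

theorem VLoop_ext_pairing {w w' : VLoop n}
    (h : ∀ η : VtLoop n, pairing w.1 η.1 = pairing w'.1 η.1) : w = w' := by
  have h0 := h ⟨_, transpose_mem_VtLoop (w - w').2⟩
  rw [← sub_eq_zero, ← pairing_sub_left] at h0
  exact sub_eq_zero.1 (Subtype.ext (eq_zero_of_pairing_transpose (w - w').1 h0))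

theorem VtLoop_ext_pairing {ξ ξ' : VtLoop n}
    (h : ∀ v : VLoop n, pairing ξ.1 v.1 = pairing ξ'.1 v.1) : ξ = ξ' := by
  have h0 := h ⟨_, transpose_mem_VLoop (ξ - ξ').2⟩
  rw [← sub_eq_zero, ← pairing_sub_left] at h0
  exact sub_eq_zero.1 (Subtype.ext (eq_zero_of_pairing_transpose (ξ - ξ').1 h0))

/-- The pairing of an element of `C^∞(S¹, V_n)` with a matrix only sees `π₀` of that matrix. -/
theorem pairing_eq_of_piZero_eq {w y z : LoopMat n} (hw : w ∈ VLoop n)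
    (h : piZero y = piZero z) : pairing w y = pairing w z := by
  rw [pairing_eq_sum, pairing_eq_sum]
  refine Finset.sum_congr rfl fun i _ => Finset.sum_congr rfl fun j _ => ?_
  by_cases hij : i.val + 1 < n ∧ j.val + 1 = n
  · have := congrFun (congrFun h j) i
    simp only [piZero, Matrix.of_apply, if_pos hij.symm] at this
    rw [this]
  · rw [hw i j hij, zero_mul, zero_mul]

theorem piZero_of_mem {y : LoopMat n} (hy : y ∈ VtLoop n) : piZero y = y := by
  ext1 i j
  by_cases h : i.val + 1 = n ∧ j.val + 1 < n
  · simp only [piZero, Matrix.of_apply, if_pos h]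
  · simp only [piZero, Matrix.of_apply, if_neg h, hy i j h]

theorem map_mul_derivation {ι A : Type*} [Fintype ι] [CommRing A] [Algebra ℝ A]
    (D : Derivation ℝ A A) (M N : Matrix ι ι A) :
    (M * N).map D = M.map D * N + M * N.map D := by
  ext i j
  simp only [Matrix.map_apply, Matrix.mul_apply, Matrix.add_apply, map_sum, Derivation.leibniz,
    smul_eq_mul, ← Finset.sum_add_distrib]
  exact Finset.sum_congr rfl fun k _ => by ring

theorem trace_map_derivation {ι A : Type*} [Fintype ι] [CommRing A] [Algebra ℝ A]
    (D : Derivation ℝ A A) (M : Matrix ι ι A) : (M.map D).trace = D M.trace := by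
  simp [Matrix.trace, map_sum]

theorem pairing_commutator (a y z : LoopMat n) :
    pairing (a * y - y * a) z = -pairing y (a * z - z * a) := by
  rw [pairing, pairing, ← circInt_neg]
  congr 1
  rw [sub_mul, mul_sub, Matrix.trace_sub, Matrix.trace_sub, mul_assoc a, Matrix.trace_mul_comm a,
    mul_assoc, mul_assoc]
  ring

/-- Integration by parts on the circle together with the invariance of the trace form. -/
theorem pairing_covDeriv (u y z : LoopMat n) :
    pairing (covDeriv u y) z = -pairing y (covDeriv u z) := by
  have h : pairing (y.map dx) z = -pairing y (z.map dx) := by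
    have := circInt_dx (y * z).trace
    rw [← trace_map_derivation, map_mul_derivation, Matrix.trace_add, circInt_add] at this
    exact eq_neg_of_add_eq_zero_left this
  rw [covDeriv, covDeriv, pairing_add_left, pairing_commutator, h, pairing_comm y (_ + _),
    pairing_add_left, pairing_comm (z.map _), pairing_comm (_ - _)]
  ring

/-- A system of equations `E y = t` for a sequence `y`, whose `j`-th equation determines `y j`
in terms of the `y i` with `i < j`, has a unique solution. -/
theorem existsUnique_of_triangular {R : Type*} [AddCommGroup R] [Module ℝ R]
    (E : (ℕ → R) → ℕ → R) (ν : ℕ → ℝ) (hν : ∀ j, ν j ≠ 0)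
    (h : ∀ j y y', (∀ i < j, y i = y' i) → E y j - E y' j = ν j • (y j - y' j)) (t : ℕ → R) :
    ∃! y, E y = t := by
  -- Stage `m` corrects coordinate `m` alone, by its residual divided by `ν m`; earlier coordinates
  -- stay untouched, so coordinate `i` is final from stage `i + 1` on.
  let a : ℕ → ℕ → R := fun m => Nat.rec (fun _ => 0)
    (fun m y => Function.update y m (y m + (ν m)⁻¹ • (t m - E y m))) m
  have ha : ∀ m, a (m + 1) =
      Function.update (a m) m (a m m + (ν m)⁻¹ • (t m - E (a m) m)) := fun _ => rfl
  have hst : ∀ i k, a (i + 1 + k) i = a (i + 1) i := by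
    intro i k
    induction k with
    | zero => rfl
    | succ k ih => rw [← add_assoc, ha, Function.update_of_ne (by omega), ih]
  refine ⟨fun i => a (i + 1) i, funext fun j => ?_, fun y hy => funext fun j => ?_⟩
  · have h1 := h j (fun i => a (i + 1) i) (a j) fun i hi => by
      obtain ⟨k, rfl⟩ : ∃ k, j = i + 1 + k := ⟨j - (i + 1), by omega⟩
      exact (hst i k).symm
    have h2 : a (j + 1) j = a j j + (ν j)⁻¹ • (t j - E (a j) j) := by
      rw [ha, Function.update_self]
    rw [h2, add_sub_cancel_left, smul_inv_smul₀ (hν j)] at h1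
    exact sub_left_injective h1
  · induction j using Nat.strong_induction_on with
    | _ j ih =>
      have h1 := h j (fun i => a (i + 1) i) (a j) fun i hi => by
        obtain ⟨k, rfl⟩ : ∃ k, j = i + 1 + k := ⟨j - (i + 1), by omega⟩
        exact (hst i k).symm
      have h2 : a (j + 1) j = a j j + (ν j)⁻¹ • (t j - E (a j) j) := by
        rw [ha, Function.update_self]
      rw [h2, add_sub_cancel_left, smul_inv_smul₀ (hν j)] at h1
      have h3 := h j y (fun i => a (i + 1) i) ih
      rw [hy, sub_left_injective h1, sub_self, eq_comm, smul_eq_zero, or_iff_right (hν j)] at h3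
      exact sub_eq_zero.1 h3

/-! ### Column recursions over a differential ring. -/

section Array

variable {R : Type*} [CommRing R] [Algebra ℝ R] (D : Derivation ℝ R R)

/-- The columns `(D + b + u)^j c`, where `u` is concentrated in the last column. -/
def colArray (n : ℕ) (u c : ℕ → R) : ℕ → ℕ → R
  | 0 => c
  | j + 1 => fun i => D (colArray n u c j i) + (if i = 0 then 0 else colArray n u c j (i - 1)) +
      u i * colArray n u c j (n - 1)

variable {D} {n : ℕ} {u : ℕ → R}

theorem colArray_succ (c : ℕ → R) (j i : ℕ) :
    colArray D n u c (j + 1) i = D (colArray D n u c j i) +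
      (if i = 0 then 0 else colArray D n u c j (i - 1)) + u i * colArray D n u c j (n - 1) :=
  rfl

theorem colArray_sub (c c' : ℕ → R) (j i : ℕ) :
    colArray D n u (c - c') j i = colArray D n u c j i - colArray D n u c' j i := by
  induction j generalizing i with
  | zero => rfl
  | succ j ih =>
    simp only [colArray_succ, ih, map_sub]
    split_ifs <;> ring

/-- The shift `b` moves the lowest nonzero entry down one row per step, undifferentiated. The `u`
term cannot interfere: the last entry is nonzero only once the support reaches row `n - 1`, where
`u` vanishes. -/
theorem colArray_of_le (hu : u (n - 1) = 0) {c : ℕ → R} {i₀ : ℕ}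
    (hc : ∀ l, i₀ < l → l < n → c l = 0) (j a : ℕ) (ha : a < n) :
    (j + i₀ < a → colArray D n u c j a = 0) ∧ (a = j + i₀ → colArray D n u c j a = c i₀) := by
  induction j generalizing a with
  | zero =>
    refine ⟨fun h => hc a (by omega) ha, fun h => ?_⟩
    rw [h, zero_add, colArray]
  | succ j ih =>
    have h2 : j + 1 + i₀ ≤ a → u a * colArray D n u c j (n - 1) = 0 := by
      intro h
      rcases eq_or_ne a (n - 1) with rfl | h'
      · rw [hu, zero_mul]
      · rw [(ih (n - 1) (by omega)).1 (by omega), mul_zero]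
    constructor
    · intro h
      rw [colArray_succ, h2 h.le, (ih a ha).1 (by omega), (ih (a - 1) (by omega)).1 (by omega)]
      simp
    · intro h
      rw [colArray_succ, h2 h.ge, (ih a ha).1 (by omega), (ih (a - 1) (by omega)).2 (by omega),
        if_neg (by omega)]
      simp

/-- One row above the leading edge, every step adds one derivative of the leading entry `c (i₀ +
1)`. -/
theorem colArray_subdiag (hu : u (n - 1) = 0) {c : ℕ → R} {i₀ : ℕ}
    (hc : ∀ l, i₀ + 1 < l → l < n → c l = 0) (j : ℕ) (ha : i₀ + j < n) :
    colArray D n u c j (i₀ + j) = c i₀ + j • D (c (i₀ + 1)) := by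
  induction j with
  | zero => simp [colArray]
  | succ j ih =>
    have h2 : u (i₀ + (j + 1)) * colArray D n u c j (n - 1) = 0 := by
      rcases eq_or_ne (i₀ + (j + 1)) (n - 1) with h | h'
      · rw [h, hu, zero_mul]
      · rw [(colArray_of_le hu hc j (n - 1) (by omega)).1 (by omega), mul_zero]
    rw [colArray_succ, h2, (colArray_of_le hu hc j _ ha).2 (by omega), if_neg (by omega),
      ← add_assoc, Nat.add_sub_cancel, ih (by omega), succ_nsmul]
    ring

variable (D n u) in
/-- The quantities that determine the first column `y (n-1), …, y 0` of the array. -/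
def colData (y : ℕ → R) (j : ℕ) : R :=
  if j < n - 1 then colArray D n u (fun i => y (n - 1 - i)) j (n - 1)
  else if j = n - 1 then ∑ a ∈ Finset.range n, colArray D n u (fun i => y (n - 1 - i)) a a
  else y j

/-- The first column is read from the bottom up. Last-row entry `j` contains the new unknown with
coefficient `1`; the trace contains the top entry `n` times, once per diagonal position. Indices `j
≥ n` only pad the system. -/
theorem existsUnique_colData (hn : 2 ≤ n) (hu : u (n - 1) = 0) (t : ℕ → R) :
    ∃! y, colData D n u y = t := by
  refine existsUnique_of_triangular _ (fun j => if j = n - 1 then n else 1) ?_ ?_ t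
  · intro j
    split_ifs
    · positivity
    · exact one_ne_zero
  · intro j y y' h
    have hc : ∀ l, n - 1 - j < l → l < n →
        ((fun i => y (n - 1 - i)) - (fun i => y' (n - 1 - i))) l = 0 := by
      intro l h1 h2
      rw [Pi.sub_apply, h _ (by omega), sub_self]
    rw [colData, colData]
    split_ifs with h1 h2
    · omega
    · rw [← colArray_sub, (colArray_of_le hu hc j _ (by omega)).2 (by omega), one_smul,
        Pi.sub_apply, show n - 1 - (n - 1 - j) = j by omega]
    · rw [← Finset.sum_sub_distrib, Finset.sum_congr rfl fun a ha => by
        rw [← colArray_sub, (colArray_of_le hu hc a a (by simpa using ha)).2 (by omega)]]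
      rw [Finset.sum_const, Finset.card_range, Pi.sub_apply,
        show n - 1 - (n - 1 - j) = j by omega, Nat.cast_smul_eq_nsmul]
    · rw [one_smul]

variable (D) in
/-- The array `q` with vanishing first column, `q (j + 1) = (D + b) q j + g j e₁`. -/
def srcArray (g : ℕ → R) : ℕ → ℕ → R
  | 0 => fun _ => 0
  | j + 1 => fun i => D (srcArray g j i) + if i = 0 then g j else srcArray g j (i - 1)

theorem srcArray_succ (g : ℕ → R) (j i : ℕ) : srcArray D g (j + 1) i =
    D (srcArray D g j i) + if i = 0 then g j else srcArray D g j (i - 1) :=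
  rfl

theorem srcArray_of_le (g : ℕ → R) (j i : ℕ) (h : j ≤ i) : srcArray D g j i = 0 := by
  induction j generalizing i with
  | zero => rfl
  | succ j ih => rw [srcArray_succ, ih i (by omega), ih (i - 1) (by omega), if_neg (by omega)]; simp

/-- The first source `g m` enters in row `0` and travels down its superdiagonal unchanged; the next
superdiagonal collects one `D (g m)` per row. -/
theorem srcArray_superdiag {g : ℕ → R} {m : ℕ} (hg : ∀ j < m, g j = 0) (i : ℕ) :
    (∀ k < m, srcArray D g (i + k + 1) i = 0) ∧ srcArray D g (i + m + 1) i = g m ∧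
      srcArray D g (i + m + 2) i = (i + 1) • D (g m) + g (m + 1) := by
  induction i with
  | zero =>
    have h0 : ∀ k < m, srcArray D g (0 + k + 1) 0 = 0 := by
      intro k
      induction k with
      | zero => intro h; simp [srcArray, hg 0 h]
      | succ k ih =>
        intro h
        rw [srcArray_succ, show 0 + (k + 1) = 0 + k + 1 by omega, ih (by omega), if_pos rfl,
          show 0 + k + 1 = k + 1 by omega, hg _ h]
        simp
    have h1 : srcArray D g (0 + m + 1) 0 = g m := by
      rw [srcArray_succ, if_pos rfl, zero_add]
      rcases m with _ | m
      · simp [srcArray]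
      · have := h0 m (by omega)
        rw [zero_add] at this
        rw [this, map_zero, zero_add]
    refine ⟨h0, h1, ?_⟩
    rw [srcArray_succ, h1, if_pos rfl, zero_add]
    simp
  | succ i ih =>
    have h0 : ∀ k < m, srcArray D g (i + 1 + k + 1) (i + 1) = 0 := by
      intro k
      induction k with
      | zero =>
        intro h
        rw [srcArray_succ, srcArray_of_le _ _ _ (by omega), if_neg (by omega), Nat.add_sub_cancel,
          show i + 1 + 0 = i + 0 + 1 by omega, ih.1 0 h]
        simp
      | succ k ihk =>
        intro h
        rw [srcArray_succ, show i + 1 + (k + 1) = i + 1 + k + 1 by omega, ihk (by omega),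
          if_neg (by omega), Nat.add_sub_cancel,
          show i + 1 + k + 1 = i + (k + 1) + 1 by omega, ih.1 _ h]
        simp
    have h1 : srcArray D g (i + 1 + m + 1) (i + 1) = g m := by
      rw [srcArray_succ, if_neg (by omega), Nat.add_sub_cancel,
        show i + 1 + m = i + m + 1 by omega, ih.2.1]
      rcases m with _ | m
      · rw [srcArray_of_le _ _ _ (by omega)]; simp
      · rw [show i + (m + 1) + 1 = i + 1 + m + 1 by omega, h0 m (by omega)]; simp
    refine ⟨h0, h1, ?_⟩
    rw [srcArray_succ, h1, if_neg (by omega), Nat.add_sub_cancel,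
      show i + 1 + m + 1 = i + m + 2 by omega, ih.2.2, succ_nsmul _ (i + 1)]
    ring

end Array

/-! ### Matrix entries and products with `b`, `e_{1n}` and `u`. -/

section Entries

variable {n : ℕ} {A : Type*} [CommRing A]

/-- The entries of a matrix, indexed by natural numbers and extended by zero. -/
def ent (C : Matrix (Fin n) (Fin n) A) (i j : ℕ) : A :=
  if h : i < n ∧ j < n then C ⟨i, h.1⟩ ⟨j, h.2⟩ else 0

@[simp]
theorem ent_val (C : Matrix (Fin n) (Fin n) A) (i j : Fin n) : ent C i j = C i j := by
  simp [ent]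

theorem ent_of_lt (C : Matrix (Fin n) (Fin n) A) {i j : ℕ} (hi : i < n) (hj : j < n) :
    ent C i j = C ⟨i, hi⟩ ⟨j, hj⟩ := by
  simp [ent, hi, hj]

theorem ent_of_le_right (C : Matrix (Fin n) (Fin n) A) {i j : ℕ} (hj : n ≤ j) :
    ent C i j = 0 := by
  rw [ent, dif_neg (by omega)]

theorem bMat_mul_apply (C : Matrix (Fin n) (Fin n) A) (i j : Fin n) :
    (bMat n A * C) i j = if i.val = 0 then 0 else ent C (i - 1) j := by
  rw [Matrix.mul_apply]
  simp only [bMat, Matrix.of_apply, ite_mul, one_mul, zero_mul]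
  split_ifs with h
  · exact Finset.sum_eq_zero fun k _ => if_neg (by omega)
  · rw [Finset.sum_eq_single ⟨i - 1, by omega⟩, if_pos (by simp; omega),
      ent_of_lt C (by omega) j.2]
    · exact fun k _ hk => if_neg fun h' => hk (Fin.ext (by simp; omega))
    · simp

theorem mul_bMat_apply (C : Matrix (Fin n) (Fin n) A) (i j : Fin n) :
    (C * bMat n A) i j = ent C i (j + 1) := by
  rw [Matrix.mul_apply]
  simp only [bMat, Matrix.of_apply, mul_ite, mul_one, mul_zero]
  by_cases h : j.val + 1 < n
  · rw [Finset.sum_eq_single ⟨j + 1, h⟩, if_pos rfl, ent_of_lt C i.2 h]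
    · exact fun k _ hk => if_neg fun h' => hk (Fin.ext h')
    · simp
  · rw [ent_of_le_right _ (by omega)]
    exact Finset.sum_eq_zero fun k _ => if_neg (by omega)

theorem e1n_mul_apply (C : Matrix (Fin n) (Fin n) A) (i j : Fin n) :
    (e1n n A * C) i j = if i.val = 0 then ent C (n - 1) j else 0 := by
  rw [Matrix.mul_apply]
  simp only [e1n, Matrix.of_apply, ite_mul, one_mul, zero_mul]
  have := i.2
  split_ifs with h
  · rw [Finset.sum_eq_single ⟨n - 1, by omega⟩, if_pos ⟨h, by simp; omega⟩,
      ent_of_lt C (by omega) j.2]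
    · exact fun k _ hk => if_neg fun h' => hk (Fin.ext (by simp; omega))
    · simp
  · exact Finset.sum_eq_zero fun k _ => if_neg fun h' => h h'.1

theorem mul_e1n_apply (C : Matrix (Fin n) (Fin n) A) (i j : Fin n) :
    (C * e1n n A) i j = if j.val + 1 = n then ent C i 0 else 0 := by
  rw [Matrix.mul_apply]
  simp only [e1n, Matrix.of_apply, mul_ite, mul_one, mul_zero]
  have := i.2
  split_ifs with h
  · rw [Finset.sum_eq_single ⟨0, by omega⟩, if_pos ⟨rfl, h⟩, ent_of_lt C i.2 (by omega)]
    · exact fun k _ hk => if_neg fun h' => hk (Fin.ext h'.1)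
    · simp
  · exact Finset.sum_eq_zero fun k _ => if_neg fun h' => h h'.2

end Entries

theorem VLoop_ent_last (u : VLoop n) : ent u.1 (n - 1) (n - 1) = 0 := by
  rcases Nat.eq_zero_or_pos n with rfl | h
  · rfl
  · rw [ent_of_lt _ (by omega) (by omega)]
    exact u.2 _ _ (by simp; omega)

theorem VLoop_mul_apply (u : VLoop n) (C : LoopMat n) (i j : Fin n) :
    (u.1 * C) i j = ent u.1 i (n - 1) * ent C (n - 1) j := by
  have := i.2
  rw [Matrix.mul_apply, Finset.sum_eq_single ⟨n - 1, by omega⟩,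
    ent_of_lt _ i.2 (by omega), ent_of_lt _ (by omega) j.2]
  · intro k _ hk
    rw [u.2 i k fun h => hk (Fin.ext (by simp; omega)), zero_mul]
  · simp

theorem mul_VLoop_apply (u : VLoop n) (C : LoopMat n) (i j : Fin n) (hj : j.val + 1 < n) :
    (C * u.1) i j = 0 := by
  rw [Matrix.mul_apply]
  refine Finset.sum_eq_zero fun k _ => ?_
  rw [u.2 k j (by omega), mul_zero]

/-! ### The operator `P_u`. -/

theorem covDeriv_apply (u : VLoop n) (C : LoopMat n) (i j : Fin n) (hj : j.val + 1 < n) :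
    covDeriv u.1 C i j = dx (C i j) + (if i.val = 0 then 0 else ent C (i - 1) j) +
      ent u.1 i (n - 1) * ent C (n - 1) j - ent C i (j + 1) := by
  simp only [covDeriv, add_mul, mul_add, Matrix.add_apply, Matrix.sub_apply, Matrix.map_apply,
    bMat_mul_apply, mul_bMat_apply, VLoop_mul_apply, mul_VLoop_apply u C i j hj]
  ring

theorem trace_covDeriv (u C : LoopMat n) : (covDeriv u C).trace = dx C.trace := by
  rw [covDeriv, Matrix.trace_add, Matrix.trace_sub, Matrix.trace_mul_comm C, sub_self, add_zero,
    trace_map_derivation]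

/-- Vanishing of column `j` of the commutator says that column `j + 1` of `C` is `∂ + b + u` applied
to column `j`. -/
theorem ent_eq_colArray {u : VLoop n} {C : LoopMat n} (h : covDeriv u.1 C ∈ VLoop n) (i j : ℕ)
    (hi : i < n) (hj : j < n) :
    ent C i j = colArray dx n (fun i => ent u.1 i (n - 1)) (fun i => ent C i 0) j i := by
  induction j generalizing i with
  | zero => rfl
  | succ j ih =>
    have h1 := h ⟨i, hi⟩ ⟨j, by omega⟩ (by simp; omega)
    rw [covDeriv_apply u C _ _ hj, ← ent_val C] at h1
    rw [colArray_succ, ← ih i hi (by omega), ← ih (i - 1) (by omega) (by omega),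
      ← ih (n - 1) (by omega) (by omega), eq_comm]
    exact sub_eq_zero.1 h1

theorem covDeriv_add (u C C' : LoopMat n) :
    covDeriv u (C + C') = covDeriv u C + covDeriv u C' := by
  have : (C + C').map dx = C.map dx + C'.map dx := Matrix.map_add dx (fun _ _ => map_add dx _ _) _ _
  rw [covDeriv, covDeriv, covDeriv, this, mul_add, add_mul C C']
  abel

theorem covDeriv_smul (u C : LoopMat n) (r : ℝ) : covDeriv u (r • C) = r • covDeriv u C := by
  have : (r • C).map dx = r • C.map dx := Matrix.ext fun i j => dx.map_smul r _
  rw [covDeriv, covDeriv, this, smul_add, smul_sub, Matrix.mul_smul, Matrix.smul_mul]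

theorem piZero_add (C C' : LoopMat n) : piZero (C + C') = piZero C + piZero C' := by
  ext1 i j
  simp only [piZero, Matrix.of_apply, Matrix.add_apply]
  split_ifs <;> simp

theorem piZero_smul (C : LoopMat n) (r : ℝ) : piZero (r • C) = r • piZero C := by
  ext1 i j
  simp only [piZero, Matrix.of_apply, Matrix.smul_apply]
  split_ifs <;> simp

theorem IsP.add {u : VLoop n} {v v' : VtLoop n} {C C' : LoopMat n} (h : IsP u v C)
    (h' : IsP u v' C') : IsP u (v + v') (C + C') := by
  refine ⟨?_, ?_, ?_⟩
  · rw [Matrix.trace_add, h.1, h'.1, add_zero]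
  · rw [piZero_add, h.2.1, h'.2.1]; rfl
  · rw [covDeriv_add]; exact add_mem h.2.2 h'.2.2

theorem IsP.smul {u : VLoop n} {v : VtLoop n} {C : LoopMat n} (h : IsP u v C) (r : ℝ) :
    IsP u (r • v) (r • C) := by
  refine ⟨?_, ?_, ?_⟩
  · rw [Matrix.trace_smul, h.1, smul_zero]
  · rw [piZero_smul, h.2.1]; rfl
  · rw [covDeriv_smul]; exact Submodule.smul_mem _ _ h.2.2

theorem IsP.ent_last {u : VLoop n} {v : VtLoop n} {C : LoopMat n} (h : IsP u v C) {j : ℕ}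
    (hj : j < n - 1) : ent C (n - 1) j = ent v.1 (n - 1) j := by
  rw [← h.2.1, ent_of_lt _ (by omega) (by omega), ent_of_lt _ (by omega) (by omega), piZero,
    Matrix.of_apply, if_pos (by simp; omega)]

/-- Zeros at the start of the last row climb up the first column: once the lower entries vanish,
last-row entry `j` is the first-column entry in row `n - 1 - j`. -/
theorem IsP.ent_zero {u : VLoop n} {v : VtLoop n} {C : LoopMat n} (h : IsP u v C) {m : ℕ}
    (hm : m < n) (hv : ∀ j < m, ent v.1 (n - 1) j = 0) :
    ∀ l, n - 1 - m < l → l < n → ent C l 0 = 0 := by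
  have : ∀ j < m, ent C (n - 1 - j) 0 = 0 := by
    intro j
    induction j using Nat.strong_induction_on with
    | _ j ih =>
      intro hj
      have h1 := (colArray_of_le (D := dx) (u := fun i => ent u.1 i (n - 1))
        (c := fun i => ent C i 0) (VLoop_ent_last u) (i₀ := n - 1 - j) (fun l h1 h2 => by
          rw [show l = n - 1 - (n - 1 - l) by omega]
          exact ih _ (by omega) (by omega)) j (n - 1) (by omega)).2 (by omega)
      rw [← h1, ← ent_eq_colArray h.2.2 _ _ (by omega) (by omega), h.ent_last (by omega), hv j hj]
  intro l h1 h2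
  rw [show l = n - 1 - (n - 1 - l) by omega]
  exact this _ (by omega)

theorem IsP.eq_zero {u : VLoop n} {C : LoopMat n} (h : IsP u 0 C) : C = 0 := by
  rcases Nat.eq_zero_or_pos n with rfl | hn
  · exact Subsingleton.elim _ _
  have h1 := h.ent_zero (m := n - 1) (by omega) fun j _ => by simp [ent]
  rw [Nat.sub_self] at h1
  have h0 := colArray_of_le (D := dx) (u := fun i => ent u.1 i (n - 1))
    (c := fun i => ent C i 0) (VLoop_ent_last u) h1
  -- Only the top entry of the first column is left; it is repeated along the whole diagonal, so the
  -- trace kills it.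
  have h2 : n • ent C 0 0 = 0 := by
    rw [← h.1, Matrix.trace, Finset.sum_congr rfl fun a _ => by
      rw [Matrix.diag_apply, ← ent_val C, ent_eq_colArray h.2.2 _ _ a.2 a.2, (h0 a a a.2).2 rfl]]
    simp
  have h3 : ent C 0 0 = 0 := by
    rw [← Nat.cast_smul_eq_nsmul ℝ, smul_eq_zero] at h2
    exact h2.resolve_left (by positivity)
  have h4 : ∀ j a, a < n → colArray dx n (fun i => ent u.1 i (n - 1)) (fun i => ent C i 0) j a
      = 0 := by
    intro j
    induction j with
    | zero =>
      intro a ha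
      rcases Nat.eq_zero_or_pos a with rfl | h'
      · exact h3
      · exact h1 a h' ha
    | succ j ih =>
      intro a ha
      rw [colArray_succ, ih a ha, ih (n - 1) (by omega), ih (a - 1) (by omega)]
      simp
  ext1 i j
  rw [← ent_val C, ent_eq_colArray h.2.2 _ _ i.2 j.2, h4 _ _ i.2, Matrix.zero_apply]

theorem existsUnique_isP (hn : 2 ≤ n) (u : VLoop n) (v : VtLoop n) :
    ∃! C : LoopMat n, IsP u v C := by
  set U : ℕ → LoopRing := fun i => ent u.1 i (n - 1) with hU
  have hu : U (n - 1) = 0 := VLoop_ent_last u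
  obtain ⟨y, hy, -⟩ := existsUnique_colData (D := dx) hn hu
    fun j => if j < n - 1 then ent v.1 (n - 1) j else 0
  refine existsUnique_of_exists_of_unique ?_ ?_
  · let C : LoopMat n := Matrix.of fun i j => colArray dx n U (fun i => y (n - 1 - i)) j i
    have hC : ∀ i j, i < n → j < n →
        ent C i j = colArray dx n U (fun i => y (n - 1 - i)) j i := fun i j hi hj => by
      rw [ent_of_lt _ hi hj]; rfl
    have htr : C.trace = 0 := by
      have := congrFun hy (n - 1)
      rw [colData, if_neg (by omega), if_pos rfl, if_neg (by omega), Finset.sum_range] at this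
      exact this
    have hz : ∀ i j : Fin n, j.val + 1 < n → covDeriv u.1 C i j = 0 := by
      intro i j hj
      rw [covDeriv_apply u C i j hj, hC i (j + 1) i.2 hj, colArray_succ,
        hC (n - 1) j (by omega) j.2, hC (i - 1) j (by omega) j.2, ← ent_val C i j,
        hC i j i.2 j.2]
      exact sub_self _
    refine ⟨C, htr, ?_, ?_⟩
    · ext1 i j
      by_cases hij : i.val + 1 = n ∧ j.val + 1 < n
      · have := congrFun hy j
        rw [colData, if_pos (by omega), if_pos (by omega)] at this
        rw [piZero, Matrix.of_apply, if_pos hij, ← ent_val C i j, ← ent_val v.1 i j,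
          show i.val = n - 1 by omega, ← this, hC _ _ (by omega) j.2]
      · rw [piZero, Matrix.of_apply, if_neg hij, v.2 i j hij]
    · intro i j hij
      by_cases hj : j.val + 1 < n
      · exact hz i j hj
      -- The corner is not covered by the recursion. It vanishes because the commutator has trace `∂
      -- tr C = 0` and its other diagonal entries are zero.
      · have h1 := trace_covDeriv u.1 C
        rw [htr, map_zero, Matrix.trace, Finset.sum_eq_single j] at h1
        · rwa [show i = j from Fin.ext (by omega)]
        · exact fun k _ hk => hz k k (by have := Fin.val_ne_of_ne hk; omega)
        · simp
  · intro C C' h h'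
    have h1 := h.add (h'.smul (-1 : ℝ))
    rw [neg_one_smul ℝ v, neg_one_smul ℝ C', add_neg_cancel, ← sub_eq_add_neg] at h1
    exact sub_eq_zero.1 h1.eq_zero

theorem isP_P (hn : 2 ≤ n) (u : VLoop n) (v : VtLoop n) : IsP u v (P u v) :=
  Classical.epsilon_spec (existsUnique_isP hn u v).exists

theorem P_add (hn : 2 ≤ n) (u : VLoop n) (v v' : VtLoop n) : P u (v + v') = P u v + P u v' :=
  (existsUnique_isP hn u _).unique (isP_P hn u _) ((isP_P hn u v).add (isP_P hn u v'))

theorem P_smul (hn : 2 ≤ n) (u : VLoop n) (r : ℝ) (v : VtLoop n) : P u (r • v) = r • P u v :=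
  (existsUnique_isP hn u _).unique (isP_P hn u _) ((isP_P hn u v).smul r)

/-! ### The first Poisson operator in closed form. -/

theorem form₁_add_left (hn : 2 ≤ n) (u : VLoop n) (ξ ξ' η : VtLoop n) :
    form₁ u (ξ + ξ') η = form₁ u ξ η + form₁ u ξ' η := by
  rw [form₁, form₁, form₁, ← pairing_add_left, P_add hn, mul_add, add_mul]
  congr 1
  abel

theorem form₁_smul_left (hn : 2 ≤ n) (u : VLoop n) (r : ℝ) (ξ η : VtLoop n) :
    form₁ u (r • ξ) η = r * form₁ u ξ η := by
  rw [form₁, form₁, ← pairing_smul_left, P_smul hn, Matrix.mul_smul, Matrix.smul_mul, smul_sub]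

theorem form₁_antisymm (u : VLoop n) (ξ η : VtLoop n) : form₁ u ξ η = -form₁ u η ξ := by
  rw [form₁, form₁, pairing_commutator, pairing_comm]

/-- The coefficient of `λ` in `P_{u + λ e_{1n}}(ξ)`. -/
def linP (u : VLoop n) (ξ : VtLoop n) : LoopMat n :=
  Matrix.of fun i j => srcArray dx (fun j => ent (P u ξ) (n - 1) j) j i

theorem ent_linP (u : VLoop n) (ξ : VtLoop n) {i j : ℕ} (hi : i < n) (hj : j < n) :
    ent (linP u ξ) i j = srcArray dx (fun j => ent (P u ξ) (n - 1) j) j i := by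
  rw [ent_of_lt _ hi hj]; rfl

theorem ent_linP_of_le (u : VLoop n) (ξ : VtLoop n) {i j : ℕ} (h : j ≤ i) :
    ent (linP u ξ) i j = 0 := by
  by_cases hi : i < n
  · rw [ent_linP u ξ hi (by omega), srcArray_of_le _ _ _ h]
  · rw [ent, dif_neg (by omega)]

theorem piZero_linP (u : VLoop n) (ξ : VtLoop n) : piZero (linP u ξ) = 0 := by
  ext1 i j
  rw [piZero, Matrix.of_apply, ← ent_val (linP u ξ)]
  split_ifs
  · exact ent_linP_of_le u ξ (by omega)
  · rfl

/-- Strict upper triangularity: `e_{1n}` only sees the last row on the right and the first column on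
the left, both zero. -/
theorem commutator_e1n_linP (u : VLoop n) (ξ : VtLoop n) :
    e1n n LoopRing * linP u ξ - linP u ξ * e1n n LoopRing = 0 := by
  ext1 i j
  rw [Matrix.sub_apply, e1n_mul_apply, mul_e1n_apply, ent_linP_of_le u ξ (by omega),
    ent_linP_of_le u ξ (by omega)]
  simp

/-- The coefficient of `λ` in `[∂_x + b + u + λ e_{1n}, P_{u + λ e_{1n}}(ξ)]`. -/
def W (u : VLoop n) (ξ : VtLoop n) : LoopMat n :=
  covDeriv u.1 (linP u ξ) + (e1n n LoopRing * P u ξ - P u ξ * e1n n LoopRing)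

/-- The source in `srcArray` is the last row of `P_u(ξ)`, chosen to cancel `e_{1n} P_u(ξ)` in these
columns. -/
theorem W_apply_of_lt (u : VLoop n) (ξ : VtLoop n) (i j : Fin n) (hj : j.val + 1 < n) :
    W u ξ i j = 0 := by
  rw [W, Matrix.add_apply, Matrix.sub_apply, covDeriv_apply u _ i j hj, e1n_mul_apply,
    mul_e1n_apply, if_neg (c := j.val + 1 = n) (by omega), ← ent_val (linP u ξ) i j, ent_linP u ξ i.2 hj, srcArray_succ,
    ent_linP u ξ i.2 j.2, ent_linP_of_le u ξ (i := n - 1) (by omega)]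
  split_ifs
  · ring
  · rw [ent_linP u ξ (by omega) j.2]
    ring

theorem W_apply_last (u : VLoop n) (ξ : VtLoop n) (i j : Fin n) (hj : j.val + 1 = n) :
    W u ξ i j = srcArray dx (fun j => ent (P u ξ) (n - 1) j) n i - ent (P u ξ) i 0 -
      ∑ k : Fin n, ent (linP u ξ) i k * u.1 k j := by
  have h1 : (linP u ξ * u.1) i j = ∑ k : Fin n, ent (linP u ξ) i k * u.1 k j := by
    simp [Matrix.mul_apply]
  obtain ⟨m, rfl⟩ : ∃ m, n = m + 1 := ⟨j, hj.symm⟩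
  have hj' : j.val = m := by omega
  rw [← h1, srcArray_succ, W]
  simp only [covDeriv, add_mul, mul_add, Matrix.add_apply, Matrix.sub_apply, Matrix.map_apply,
    bMat_mul_apply, mul_bMat_apply, VLoop_mul_apply, e1n_mul_apply, mul_e1n_apply, if_pos hj,
    ent_of_le_right (linP u ξ) hj.ge, ent_linP_of_le u ξ (show j.val ≤ m + 1 - 1 by omega)]
  rw [← ent_val (linP u ξ) i j, ent_linP u ξ i.2 j.2, ent_linP u ξ (i := i - 1) (by omega) j.2, hj']
  split_ifs
  · simp; ring
  · ring

theorem W_mem (hn : 2 ≤ n) (u : VLoop n) (ξ : VtLoop n) : W u ξ ∈ VLoop n := by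
  intro i j hij
  by_cases hj : j.val + 1 < n
  · exact W_apply_of_lt u ξ i j hj
  · obtain ⟨m, rfl⟩ : ∃ m, n = m + 2 := ⟨n - 2, by omega⟩
    have hi : i.val = m + 1 := by omega
    rw [W_apply_last u ξ i j (by omega), Finset.sum_eq_zero fun k _ => by
      rw [ent_linP_of_le u ξ (by omega), zero_mul], hi]
    -- In the corner the array contributes `g 0`, which is exactly the subtracted entry of `P_u(ξ)`
    -- in the last row and first column.
    have h := (srcArray_superdiag (D := dx) (g := fun j => ent (P u ξ) (m + 2 - 1) j) (m := 0)
      (fun _ h => absurd h (Nat.not_lt_zero _)) (m + 1)).2.1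
    rw [add_zero] at h
    rw [h]
    simp

/-- As `W` is in `V_n`, the covector `η` may be replaced by `P_u(η)`. The commutator with `linP`
then moves onto `P_u(η)`, lands in `V_n`, and pairs to zero since `π₀` of `linP` vanishes. -/
theorem pairing_W (hn : 2 ≤ n) (u : VLoop n) (ξ η : VtLoop n) :
    pairing (W u ξ) η.1 = form₁ u ξ η := by
  have h1 : piZero η.1 = piZero (P u η) := by
    rw [(isP_P hn u η).2.1, piZero_of_mem η.2]
  rw [pairing_eq_of_piZero_eq (W_mem hn u ξ) h1, W, pairing_add_left, pairing_covDeriv,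
    pairing_comm, pairing_eq_of_piZero_eq (z := 0) (isP_P hn u η).2.2, pairing_comm,
    pairing_zero_left, neg_zero, zero_add, form₁]
  rw [piZero_linP, piZero_of_mem (zero_mem (VtLoop n))]

theorem isJ₁_W (hn : 2 ≤ n) (u : VLoop n) (ξ : VtLoop n) : IsJ₁ u ξ ⟨W u ξ, W_mem hn u ξ⟩ :=
  pairing_W hn u ξ

theorem existsUnique_isJ₁ (hn : 2 ≤ n) (u : VLoop n) (ξ : VtLoop n) : ∃! w, IsJ₁ u ξ w :=
  ⟨_, isJ₁_W hn u ξ, fun w hw => VLoop_ext_pairing fun η => by rw [hw η, isJ₁_W hn u ξ η]⟩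

theorem J₁_eq (hn : 2 ≤ n) (u : VLoop n) (ξ : VtLoop n) : J₁ u ξ = ⟨W u ξ, W_mem hn u ξ⟩ :=
  (existsUnique_isJ₁ hn u ξ).unique (Classical.epsilon_spec (existsUnique_isJ₁ hn u ξ).exists)
    (isJ₁_W hn u ξ)

theorem J₁_eq_zero_iff (hn : 2 ≤ n) (u : VLoop n) (ξ : VtLoop n) :
    J₁ u ξ = 0 ↔ ∀ η, form₁ u ξ η = 0 := by
  rw [J₁_eq hn]
  constructor
  · intro h η
    rw [← pairing_W hn, show W u ξ = 0 from congrArg Subtype.val h, pairing_zero_left]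
  · intro h
    refine VLoop_ext_pairing fun η => ?_
    rw [pairing_W hn, h, ZeroMemClass.coe_zero, pairing_zero_left]

/-! ### Leading entries of kernel elements. -/

/-- The kernel of the Poisson operator. -/
def kerJ₁ (hn : 2 ≤ n) (u : VLoop n) : Submodule ℝ (VtLoop n) where
  carrier := {ξ | J₁ u ξ = 0}
  add_mem' := fun {ξ ξ'} h h' => (J₁_eq_zero_iff hn u _).2 fun η => by
    rw [form₁_add_left hn, (J₁_eq_zero_iff hn u ξ).1 h, (J₁_eq_zero_iff hn u ξ').1 h', add_zero]
  zero_mem' := (J₁_eq_zero_iff hn u _).2 fun η => by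
    rw [← zero_smul ℝ (0 : VtLoop n), form₁_smul_left hn, zero_mul]
  smul_mem' := fun r ξ h => (J₁_eq_zero_iff hn u _).2 fun η => by
    rw [form₁_smul_left hn, (J₁_eq_zero_iff hn u ξ).1 h, mul_zero]

/-- The first nonzero component of an element of the kernel of `(J₁)_u` is constant. -/
theorem dx_ent_eq_zero_of_J₁_eq_zero (hn : 2 ≤ n) {u : VLoop n} {ξ : VtLoop n}
    (h : J₁ u ξ = 0) {m : ℕ} (hm : m < n - 1) (hξ : ∀ j < m, ent ξ.1 (n - 1) j = 0) :
    dx (ent ξ.1 (n - 1) m) = 0 := by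
  -- Row `i = n - 2 - m` of the last column of `W` is the one in which only `∂ξ_m` survives.
  obtain ⟨i, rfl⟩ : ∃ i, n = i + m + 2 := ⟨n - 2 - m, by omega⟩
  have hP := isP_P hn u ξ
  rw [J₁_eq hn] at h
  have hW : W u ξ ⟨i, by omega⟩ ⟨i + m + 1, by omega⟩ = 0 := by
    rw [show W u ξ = 0 from congrArg Subtype.val h]; rfl
  have hc := hP.ent_zero (m := m) (by omega) hξ
  rw [show i + m + 2 - 1 - m = i + 1 by omega] at hc
  have hg : ∀ j < m, ent (P u ξ) (i + m + 2 - 1) j = 0 := fun j hj => by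
    rw [hP.ent_last (by omega), hξ j hj]
  have hs := srcArray_superdiag (D := dx) hg i
  rw [W_apply_last u ξ _ _ rfl, Finset.sum_eq_zero fun k _ => ?_, sub_zero, hs.2.2] at hW
  · have h1 := (colArray_of_le (D := dx) (u := fun l => ent u.1 l (i + m + 2 - 1))
      (c := fun l => ent (P u ξ) l 0) (VLoop_ent_last u) hc m (i + m + 2 - 1) (by omega)).2
      (by omega)
    rw [← ent_eq_colArray hP.2.2 _ _ (by omega) (by omega)] at h1
    have h2 := colArray_subdiag (D := dx) (u := fun l => ent u.1 l (i + m + 2 - 1))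
      (c := fun l => ent (P u ξ) l 0) (VLoop_ent_last u) hc (m + 1) (by omega)
    rw [← ent_eq_colArray hP.2.2 _ _ (by omega) (by omega),
      show i + (m + 1) = i + m + 2 - 1 by omega, ← h1] at h2
    rw [h2, hP.ent_last hm] at hW
    generalize dx (ent ξ.1 (i + m + 2 - 1) m) = x at hW ⊢
    -- The array gives `i + 1` copies of `∂ξ_m`, and the last-row entry `m + 1` of `P_u(ξ)`,
    -- compared with its first column, gives `m + 1` more: `n` in total.
    have h3 : (i + m + 2) • x = 0 := by
      have h4 : (i + m + 2) • x = (i + 1) • x + (m + 1) • x := by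
        rw [← add_nsmul]; congr 1; omega
      rw [h4, ← hW]
      abel
    rw [← Nat.cast_smul_eq_nsmul ℝ, smul_eq_zero] at h3
    exact h3.resolve_left (by positivity)
  -- Row `i` of `linP` vanishes up to the diagonal, and also through column `i + m` because the
  -- sources start at `m`; the last column meets the zero corner of `u`.
  · by_cases hk : k.val + 1 < i + m + 2
    · rcases le_or_gt k.val i with h' | h'
      · rw [ent_linP_of_le u ξ h', zero_mul]
      · rw [ent_linP u ξ (by simp; omega) k.2]
        have := hs.1 (k - i - 1) (by omega)
        rw [show i + (k.val - i - 1) + 1 = k by omega] at this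
        rw [this, zero_mul]
    · rw [u.2 k _ (by simp; omega), mul_zero]

/-! ### Power series in `J⁻¹`. -/

open PowerSeries in
/-- A derivation applied to the coefficients of a power series. -/
def psD {R : Type*} [CommRing R] [Algebra ℝ R] (D : Derivation ℝ R R) :
    Derivation ℝ R⟦X⟧ R⟦X⟧ :=
  Derivation.mk'
    { toFun := fun f => PowerSeries.mk fun k => D (coeff k f)
      map_add' := fun f g => by ext k; simp
      map_smul' := fun c f => by ext k; simp }
    (fun f g => by
      ext k
      simp only [LinearMap.coe_mk, AddHom.coe_mk, coeff_mk, coeff_mul, map_sum, Derivation.leibniz,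
        smul_eq_mul, map_add, Finset.sum_add_distrib]
      rw [add_right_inj, ← Finset.Nat.sum_antidiagonal_swap]
      rfl)

theorem coeff_psD {R : Type*} [CommRing R] [Algebra ℝ R] (D : Derivation ℝ R R) (f : R⟦X⟧)
    (k : ℕ) : PowerSeries.coeff k (psD D f) = D (PowerSeries.coeff k f) :=
  PowerSeries.coeff_mk k fun k => D (PowerSeries.coeff k f)

section JS

variable {R : Type*} [CommRing R] {n : ℕ}

open PowerSeries

theorem mul_JInv_apply (M : Matrix (Fin n) (Fin n) R⟦X⟧) (a c : Fin n) :
    (M * JInv n R) a c = if c.val = 0 then X * ent M a (n - 1) else ent M a (c - 1) := by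
  have hK : ∀ m : Fin n, JInv n R m c = (if c.val = m.val + 1 then 1 else 0) +
      (if c.val = 0 ∧ m.val + 1 = n then X else 0) := by
    intro m
    simp [JInv, e1n, bMat]
  have := c.2
  rw [Matrix.mul_apply]
  split_ifs with h
  · rw [Finset.sum_eq_single ⟨n - 1, by omega⟩, hK, if_neg (by omega),
      if_pos ⟨h, by simp; omega⟩, zero_add, ent_of_lt M a.2 (by omega), mul_comm]
    · intro m _ hm
      rw [hK, if_neg (by omega), if_neg, add_zero, mul_zero]
      exact fun h' => hm (Fin.ext (by simp; omega))
    · simp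
  · rw [Finset.sum_eq_single ⟨c - 1, by omega⟩, hK, if_pos (by simp; omega),
      if_neg (by omega), add_zero, ent_of_lt M a.2 (by omega), mul_one]
    · intro m _ hm
      rw [hK, if_neg, if_neg (by omega), add_zero, mul_zero]
      exact fun h' => hm (Fin.ext (by simp; omega))
    · simp

theorem JInv_mul_apply (M : Matrix (Fin n) (Fin n) R⟦X⟧) (a c : Fin n) :
    (JInv n R * M) a c = if a.val + 1 = n then X * ent M 0 c else ent M (a + 1) c := by
  have hK : ∀ m : Fin n, JInv n R a m = (if m.val = a.val + 1 then 1 else 0) +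
      (if m.val = 0 ∧ a.val + 1 = n then X else 0) := by
    intro m
    simp [JInv, e1n, bMat]
  have := a.2
  rw [Matrix.mul_apply]
  split_ifs with h
  · rw [Finset.sum_eq_single ⟨0, by omega⟩, hK, if_neg (by simp),
      if_pos ⟨rfl, h⟩, zero_add, ent_of_lt M (by omega) c.2]
    · intro m _ hm
      rw [hK, if_neg (by omega), if_neg, add_zero, zero_mul]
      exact fun h' => hm (Fin.ext h'.1)
    · simp
  · rw [Finset.sum_eq_single ⟨a + 1, by omega⟩, hK, if_pos rfl,
      if_neg (by simp), add_zero, ent_of_lt M (by omega) c.2, one_mul]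
    · intro m _ hm
      rw [hK, if_neg, if_neg (by omega), add_zero, zero_mul]
      exact fun h' => hm (Fin.ext h')
    · simp

theorem coeff_JInv_pow_eq (i k : ℕ) (a c : Fin n) :
    coeff k ((JInv n R ^ i) a c) = if a.val + i = c.val + n * k then 1 else 0 := by
  split_ifs with h
  · induction i generalizing k c with
    | zero =>
      have h1 : k = 0 := by
        by_contra hk
        have := Nat.le_mul_of_pos_right n (Nat.pos_of_ne_zero hk)
        have := a.2
        omega
      subst h1
      rw [pow_zero, show a = c from Fin.ext (by omega), Matrix.one_apply_eq, coeff_zero_one]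
    | succ i ih =>
      have := c.2
      rw [pow_succ, mul_JInv_apply]
      split_ifs with hc
      · rcases k with _ | k
        · omega
        · rw [coeff_succ_X_mul, ent_of_lt _ a.2 (by omega)]
          exact ih k _ (by rw [Nat.mul_add] at h; simp; omega)
      · rw [ent_of_lt _ a.2 (by omega)]
        exact ih k _ (by simp; omega)
  · by_contra h'
    exact h (coeff_JInv_pow n i k a c h')

theorem coeff_JSeries (f : ℕ → R) (k : ℕ) (a c : Fin n) : coeff k (JSeries f a c) =
    if a.val ≤ c.val + n * k then f (c.val + n * k - a.val) else 0 := by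
  rw [JSeries, Matrix.of_apply, coeff_mk]
  simp only [coeff_JInv_pow_eq, mul_ite, mul_one, mul_zero]
  split_ifs with h
  · rw [finsum_eq_single _ (c.val + n * k - a.val) fun i hi => if_neg (by omega),
      if_pos (by omega)]
  · exact finsum_eq_zero_of_forall_eq_zero fun i => if_neg (by omega)

variable (n) in
/-- The image of `g(J⁻¹)`, for a power series `g`. -/
def JS (g : R⟦X⟧) : Matrix (Fin n) (Fin n) R⟦X⟧ := JSeries fun i => coeff i g

theorem coeff_JS (g : R⟦X⟧) (k : ℕ) (a c : Fin n) : coeff k (JS n g a c) =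
    if a.val ≤ c.val + n * k then coeff (c.val + n * k - a.val) g else 0 :=
  coeff_JSeries _ k a c

theorem JS_mk (f : ℕ → R) : JS n (PowerSeries.mk f) = JSeries f := by
  rw [JS]
  simp only [coeff_mk]

theorem JS_add (g h : R⟦X⟧) : JS n (g + h) = JS n g + JS n h := by
  ext a c k
  simp only [Matrix.add_apply, map_add, coeff_JS]
  split_ifs <;> simp

theorem JS_C (r : R) : JS n (C r) = C r • (1 : Matrix (Fin n) (Fin n) R⟦X⟧) := by
  ext a c k
  have := a.2
  have := c.2
  rw [coeff_JS, Matrix.smul_apply, Matrix.one_apply, smul_eq_mul, coeff_C_mul]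
  rcases k with _ | k
  · simp only [coeff_C, mul_zero, add_zero, Fin.ext_iff]
    split_ifs <;> first | (exfalso; omega) | simp
  · rw [Nat.mul_add, mul_one, if_pos (by omega), coeff_C, if_neg (by omega)]
    split_ifs
    · rw [coeff_one, if_neg (by omega), mul_zero]
    · simp

theorem JS_one : JS n (1 : R⟦X⟧) = 1 := by
  rw [← map_one (C (R := R)), JS_C, map_one, one_smul]

theorem JS_X_mul (g : R⟦X⟧) : JS n (X * g) = JS n g * JInv n R := by
  ext a c k
  have ha := a.2
  have hc := c.2
  rw [coeff_JS, mul_JInv_apply]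
  have hX : ∀ m, coeff m (X * g) = if m = 0 then 0 else coeff (m - 1) g := by
    intro m
    rcases m with _ | m
    · simp
    · rw [coeff_succ_X_mul, if_neg (by omega), Nat.add_sub_cancel]
  rw [hX]
  by_cases h0 : c.val = 0
  · rw [if_pos h0]
    rcases k with _ | k
    · rw [coeff_zero_X_mul]
      split_ifs <;> first | rfl | (exfalso; omega)
    · rw [coeff_succ_X_mul, ent_of_lt _ ha (by omega), coeff_JS, Nat.mul_add, mul_one]
      simp only
      rw [if_pos (by omega), if_neg (by omega), if_pos (by omega)]
      congr 2
      omega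
  · rw [if_neg h0, ent_of_lt _ ha (by omega), coeff_JS]
    simp only
    by_cases h1 : a.val ≤ c.val + n * k
    · by_cases h2 : a.val = c.val + n * k
      · rw [if_pos h1, if_pos (by omega), if_neg (by omega)]
      · rw [if_pos h1, if_neg (by omega), if_pos (by omega)]
        congr 2
        omega
    · rw [if_neg h1, if_neg (by omega)]

theorem JS_X : JS n (X : R⟦X⟧) = JInv n R := by
  rw [← mul_one (X : R⟦X⟧), JS_X_mul, JS_one, one_mul]

theorem JS_X_pow (i : ℕ) : JS n ((X : R⟦X⟧) ^ i) = JInv n R ^ i := by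
  induction i with
  | zero => rw [pow_zero, pow_zero, JS_one]
  | succ i ih => rw [pow_succ', JS_X_mul, ih, pow_succ]

theorem JInv_pow_self : JInv n R ^ n = (X : R⟦X⟧) • 1 := by
  ext a c k
  have := a.2
  have := c.2
  rw [coeff_JInv_pow_eq, Matrix.smul_apply, Matrix.one_apply, smul_eq_mul]
  rcases k with _ | _ | k
  · rw [coeff_zero_X_mul, if_neg (by omega)]
  · rw [coeff_succ_X_mul]
    simp only [Fin.ext_iff]
    split_ifs <;> first | (exfalso; omega) | simp
  · rw [coeff_succ_X_mul, if_neg (by rw [Nat.mul_add, Nat.mul_add]; omega)]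
    split_ifs <;> simp [coeff_one]

/-- Multiplicativity is clear for constants and for a factor `X`, so peeling off the terms of `h`
leaves a defect divisible by arbitrarily high powers of `J⁻¹`. -/
theorem JS_mul (g h : R⟦X⟧) : JS n (g * h) = JS n g * JS n h := by
  -- the defect is divisible by every power of `X`
  have step : ∀ (N : ℕ) (h : R⟦X⟧), ∃ h', JS n (g * h) - JS n g * JS n h =
      (JS n (g * h') - JS n g * JS n h') * JInv n R ^ N := by
    intro N
    induction N with
    | zero => exact fun h => ⟨h, by rw [pow_zero, mul_one]⟩
    | succ N ih =>
      intro h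
      obtain ⟨h', hh'⟩ := ih (PowerSeries.mk fun p => coeff (p + 1) h)
      have hC : ∀ (g : R⟦X⟧) (r : R), JS n (g * C r) = JS n g * JS n (C r) := by
        intro g r
        ext a c k
        rw [JS_C, mul_smul_comm, mul_one, Matrix.smul_apply, smul_eq_mul, coeff_C_mul, coeff_JS,
          coeff_JS]
        split_ifs
        · rw [coeff_mul_C, mul_comm]
        · rw [mul_zero]
      refine ⟨h', ?_⟩
      rw [pow_succ, ← mul_assoc, ← hh']
      conv_lhs => rw [eq_X_mul_shift_add_const h]
      rw [mul_add, JS_add, JS_add, mul_add, hC, mul_left_comm, JS_X_mul, JS_X_mul, sub_mul,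
        mul_assoc]
      abel
  rw [← sub_eq_zero]
  ext a c k
  -- Since `J⁻ⁿ = λ⁻¹`, this exponent gives a factor `λ^{-(k+1)}`, which kills the coefficient of
  -- order `k`.
  obtain ⟨h', hh'⟩ := step (n * (k + 1)) h
  rw [hh', pow_mul, JInv_pow_self, smul_pow, one_pow, mul_smul_comm, mul_one, Matrix.smul_apply,
    smul_eq_mul, coeff_X_pow_mul', if_neg (by omega)]
  simp

variable (n R) in
/-- `g ↦ g(J⁻¹)` as a ring homomorphism. -/
def JSHom : R⟦X⟧ →+* Matrix (Fin n) (Fin n) R⟦X⟧ where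
  toFun := JS n
  map_one' := JS_one
  map_mul' := JS_mul
  map_zero' := by rw [← map_zero (C (R := R)), JS_C, map_zero, zero_smul]
  map_add' := JS_add

theorem JS_sub (g h : R⟦X⟧) : JS n (g - h) = JS n g - JS n h := map_sub (JSHom R n) g h

theorem JS_sum {ι : Type*} (s : Finset ι) (g : ι → R⟦X⟧) :
    JS n (∑ i ∈ s, g i) = ∑ i ∈ s, JS n (g i) := map_sum (JSHom R n) g s

theorem JS_C_mul (r : R) (g : R⟦X⟧) : JS n (C r * g) = C r • JS n g := by
  rw [JS_mul, JS_C, smul_mul_assoc, one_mul]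

theorem JS_comm (g h : R⟦X⟧) : JS n g * JS n h = JS n h * JS n g := by
  rw [← JS_mul, mul_comm, JS_mul]

theorem JS_X_pow_mul_apply (g : R⟦X⟧) (d : ℕ) (a c c' : Fin n) (h : c'.val = c.val + d) :
    JS n (X ^ d * g) a c' = JS n g a c := by
  ext k
  rw [coeff_JS, coeff_JS, coeff_X_pow_mul', h]
  by_cases h1 : a.val ≤ c.val + n * k
  · rw [if_pos (by omega), if_pos (by omega), if_pos h1]
    congr 2
    omega
  · rw [if_neg h1]
    split_ifs <;> first | rfl | (exfalso; omega)

/-- The last column displays every coefficient of `g`: number `m` sits in row `n - 1 - m % n` at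
order `m / n`. -/
theorem eq_zero_of_JS_last {g : R⟦X⟧} (c : Fin n) (hc : c.val + 1 = n)
    (h : ∀ a, JS n g a c = 0) : g = 0 := by
  ext m
  have hn : 0 < n := by omega
  have hlt := Nat.mod_lt m hn
  have h1 := congrArg (coeff (m / n)) (h ⟨n - 1 - m % n, by omega⟩)
  rw [coeff_JS, if_pos (by simp; omega)] at h1
  have h2 := Nat.div_add_mod m n
  rwa [show c.val + n * (m / n) - (n - 1 - m % n) = m by omega] at h1

theorem map_JS [Algebra ℝ R] (D : Derivation ℝ R R) (g : R⟦X⟧) :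
    (JS n g).map (psD D) = JS n (psD D g) := by
  ext a c k
  rw [coeff_JS, Matrix.map_apply, coeff_psD, coeff_JS, coeff_psD]
  split_ifs <;> simp

theorem map_JS_ringHom {S : Type*} [CommRing S] (φ : R →+* S) (g : R⟦X⟧) :
    (JS n g).map (PowerSeries.map φ) = JS n (PowerSeries.map φ g) := by
  ext a c k
  rw [coeff_JS, Matrix.map_apply, coeff_map, coeff_JS]
  split_ifs <;> simp

variable (n R) in
/-- `λ⁻¹ J = e_{1n} + λ⁻¹ b`. -/
def XJ : Matrix (Fin n) (Fin n) R⟦X⟧ := e1n n R⟦X⟧ + (X : R⟦X⟧) • bMat n R⟦X⟧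

theorem XJ_mul_JInv : XJ R n * JInv n R = (X : R⟦X⟧) • 1 := by
  ext1 a c
  have ha := a.2
  have hc := c.2
  rw [mul_JInv_apply, Matrix.smul_apply, Matrix.one_apply, smul_eq_mul]
  split_ifs with h1 h2 h2
  · subst h2
    rw [ent_of_lt _ ha (by omega)]
    simp [XJ, e1n, bMat, h1, show n - 1 + 1 = n by omega]
  · have : a.val ≠ 0 := fun h => h2 (Fin.ext (by omega))
    rw [ent_of_lt _ ha (by omega)]
    simp [XJ, e1n, bMat, this, show n - 1 + 1 = n by omega, show a.val ≠ n by omega]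
  · subst h2
    rw [ent_of_lt _ ha (by omega)]
    have h3 : a.val - 1 + 1 = a.val := by omega
    simp [XJ, e1n, bMat, h1, h3, ha.ne]
  · rw [ent_of_lt _ ha (by omega)]
    have : a.val ≠ c.val := fun h => h2 (Fin.ext h)
    simp [XJ, e1n, bMat, show a.val ≠ c.val - 1 + 1 by omega, show c.val - 1 + 1 ≠ n by omega]

theorem JInv_mul_XJ : JInv n R * XJ R n = (X : R⟦X⟧) • 1 := by
  ext1 a c
  have ha := a.2
  have hc := c.2
  rw [JInv_mul_apply, Matrix.smul_apply, Matrix.one_apply, smul_eq_mul]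
  split_ifs with h1 h2 h2
  · subst h2
    rw [ent_of_lt _ (by omega) hc]
    simp [XJ, e1n, bMat, h1]
  · have : c.val + 1 ≠ n := fun h => h2 (Fin.ext (by omega))
    rw [ent_of_lt _ (by omega) hc]
    simp [XJ, e1n, bMat, this]
  · subst h2
    rw [ent_of_lt _ (by omega) hc]
    simp [XJ, e1n, bMat]
  · rw [ent_of_lt _ (by omega) hc]
    have : a.val ≠ c.val := fun h => h2 (Fin.ext h)
    simp [XJ, e1n, bMat, this]

theorem XJ_mul_JS_X_mul (g : R⟦X⟧) : XJ R n * JS n (X * g) = (X : R⟦X⟧) • JS n g := by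
  rw [JS_mul, JS_X, ← mul_assoc, XJ_mul_JInv, smul_mul_assoc, one_mul]

theorem mul_XJ_apply (T : Matrix (Fin n) (Fin n) R⟦X⟧) (a c : Fin n) :
    (T * XJ R n) a c = (if c.val + 1 = n then ent T a 0 else 0) + X * ent T a (c + 1) := by
  rw [XJ, mul_add, Matrix.add_apply, mul_e1n_apply, mul_smul_comm, Matrix.smul_apply,
    mul_bMat_apply, smul_eq_mul]

end JS

/-! ### The scalar Riccati equation. -/

section Riccati

variable {R : Type*} [CommRing R] [Algebra ℝ R] (D : Derivation ℝ R R)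

open PowerSeries

theorem psD_X_pow_mul (i : ℕ) (g : R⟦X⟧) : psD D (X ^ i * g) = X ^ i * psD D g := by
  ext k
  rw [coeff_psD, coeff_X_pow_mul', coeff_X_pow_mul', coeff_psD]
  split_ifs
  · rfl
  · exact map_zero D

/-- `X ^ m ψ⁻¹ ∂ ^ m ψ`, where `ψ` is the wave function with logarithmic derivative
`X⁻¹ + f`. -/
def wave (f : R⟦X⟧) : ℕ → R⟦X⟧
  | 0 => 1
  | m + 1 => X * psD D (wave f m) + (1 + X * f) * wave f m

/-- The Riccati equation for the logarithmic derivative of the wave function. -/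
def riccati (n : ℕ) (u : ℕ → R) (f : R⟦X⟧) : R⟦X⟧ :=
  wave D f n - 1 - ∑ i ∈ Finset.range (n - 1), C (u i) * X ^ (n - i) * wave D f i

variable {D}

theorem wave_succ (f : R⟦X⟧) (m : ℕ) :
    wave D f (m + 1) = X * psD D (wave D f m) + (1 + X * f) * wave D f m := rfl

theorem constantCoeff_wave (f : R⟦X⟧) (m : ℕ) : constantCoeff (wave D f m) = 1 := by
  induction m with
  | zero => exact map_one _
  | succ m ih => simp [wave_succ, ih]

/-- To leading order `wave f m` behaves like `(1 + X f)^m`, hence the factor `m`; derivatives come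
with an additional `X`. -/
theorem wave_sub {f f' d : R⟦X⟧} {i : ℕ} (h : f - f' = X ^ i * d) (m : ℕ) :
    ∃ q, wave D f m - wave D f' m = X ^ (i + 1) * q ∧
      constantCoeff q = m • constantCoeff d := by
  induction m with
  | zero => exact ⟨0, by simp [wave], by simp⟩
  | succ m ih =>
    obtain ⟨q, hq, hq0⟩ := ih
    refine ⟨X * psD D q + q + d * wave D f m + X * f' * q, ?_, ?_⟩
    · have h1 : psD D (wave D f m) - psD D (wave D f' m) = X ^ (i + 1) * psD D q := by
        rw [← map_sub, hq, psD_X_pow_mul]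
      rw [wave_succ, wave_succ]
      linear_combination X * h1 + hq + X * wave D f m * h + X * f' * hq
    · simp only [map_add, map_mul, constantCoeff_X, zero_mul, constantCoeff_wave, hq0, succ_nsmul]
      ring

/-- Terms with `u l` carry a positive power `X^(n - l)`, so their variation is of higher order and
only `wave f n` contributes. -/
theorem coeff_riccati_sub {n : ℕ} (u : ℕ → R) {f f' d : R⟦X⟧} {i : ℕ}
    (h : f - f' = X ^ i * d) :
    coeff (i + 1) (riccati D n u f) - coeff (i + 1) (riccati D n u f') =
      n • constantCoeff d := by
  choose q hq hq0 using wave_sub (D := D) h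
  have h1 : riccati D n u f - riccati D n u f' =
      X ^ (i + 1) * (q n - ∑ l ∈ Finset.range (n - 1), C (u l) * X ^ (n - l) * q l) := by
    have h2 : ∑ l ∈ Finset.range (n - 1), C (u l) * X ^ (n - l) * wave D f l -
        ∑ l ∈ Finset.range (n - 1), C (u l) * X ^ (n - l) * wave D f' l =
        X ^ (i + 1) * ∑ l ∈ Finset.range (n - 1), C (u l) * X ^ (n - l) * q l := by
      rw [← Finset.sum_sub_distrib, Finset.mul_sum]
      refine Finset.sum_congr rfl fun l _ => ?_
      linear_combination C (u l) * X ^ (n - l) * hq l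
    rw [riccati, riccati]
    linear_combination hq n - h2
  rw [← map_sub, h1, coeff_X_pow_mul', if_pos le_rfl, Nat.sub_self,
    coeff_zero_eq_constantCoeff_apply, map_sub, hq0, map_sum, Finset.sum_eq_zero, sub_zero]
  intro l hl
  have := Finset.mem_range.1 hl
  rw [map_mul, map_mul, map_pow, constantCoeff_X, zero_pow (by omega), mul_zero, zero_mul]

/-- Order zero holds identically, so order `j + 1` is the equation that fixes `f j`, with invertible
coefficient `n`. -/
theorem existsUnique_riccati {n : ℕ} (hn : 0 < n) (u : ℕ → R) :
    ∃! f : ℕ → R, riccati D n u (PowerSeries.mk f) = 0 := by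
  have h0 : ∀ f : R⟦X⟧, coeff 0 (riccati D n u f) = 0 := by
    intro f
    rw [coeff_zero_eq_constantCoeff_apply, riccati, map_sub, map_sub, constantCoeff_wave, map_one,
      sub_self, map_sum, Finset.sum_eq_zero, sub_zero]
    intro l hl
    have := Finset.mem_range.1 hl
    rw [map_mul, map_mul, map_pow, constantCoeff_X, zero_pow (by omega), mul_zero, zero_mul]
  have h1 := existsUnique_of_triangular
    (fun f j => coeff (j + 1) (riccati D n u (PowerSeries.mk f))) (fun _ => (n : ℝ))
    (fun _ => by positivity) (fun j y y' h => by
      rw [coeff_riccati_sub (i := j) (d := PowerSeries.mk fun k => y (j + k) - y' (j + k)),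
        Nat.cast_smul_eq_nsmul]
      · rw [← coeff_zero_eq_constantCoeff_apply, coeff_mk, add_zero]
      · ext k
        rw [map_sub, coeff_mk, coeff_mk, coeff_X_pow_mul']
        split_ifs with hk
        · rw [coeff_mk, Nat.add_sub_cancel' hk]
        · rw [h k (by omega), sub_self]) 0
  refine (existsUnique_congr fun f => ?_).1 h1
  constructor
  · intro h
    ext (_ | k)
    · exact h0 _
    · exact congrFun h k
  · intro h
    funext j
    simp only [h, map_zero, Pi.zero_apply]

theorem map_wave {S : Type*} [CommRing S] [Algebra ℝ S] {D' : Derivation ℝ S S} (φ : R →+* S)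
    (hφ : ∀ r, φ (D r) = D' (φ r)) (f : R⟦X⟧) (m : ℕ) :
    PowerSeries.map φ (wave D f m) = wave D' (PowerSeries.map φ f) m := by
  have h : ∀ g, PowerSeries.map φ (psD D g) = psD D' (PowerSeries.map φ g) := by
    intro g
    ext k
    rw [coeff_map, coeff_psD, coeff_psD, coeff_map, hφ]
  induction m with
  | zero => exact map_one _
  | succ m ih => simp only [wave_succ, map_add, map_mul, map_one, PowerSeries.map_X, h, ih]

theorem map_riccati {S : Type*} [CommRing S] [Algebra ℝ S] {D' : Derivation ℝ S S} (φ : R →+* S)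
    (hφ : ∀ r, φ (D r) = D' (φ r)) (n : ℕ) (u : ℕ → R) (f : R⟦X⟧) :
    PowerSeries.map φ (riccati D n u f) =
      riccati D' n (fun i => φ (u i)) (PowerSeries.map φ f) := by
  simp only [riccati, map_sub, map_sum, map_mul, map_pow, map_one, PowerSeries.map_X,
    PowerSeries.map_C, map_wave φ hφ]

end Riccati

/-! ### The dressing equation and its reduction to the Riccati equation. -/

section LastColumn

variable {R : Type*} [CommRing R] {n : ℕ}

open PowerSeries

variable (n) in
/-- The matrix with last column `u`, where the entry in the corner is zero. -/
def uMat (u : ℕ → R) : Matrix (Fin n) (Fin n) R⟦X⟧ :=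
  Matrix.of fun i j => if i.val + 1 < n ∧ j.val + 1 = n then C (u i) else 0

theorem mul_uMat_apply (T : Matrix (Fin n) (Fin n) R⟦X⟧) (u : ℕ → R) (a c : Fin n) :
    (T * uMat n u) a c =
      if c.val + 1 = n then ∑ i ∈ Finset.range (n - 1), ent T a i * C (u i) else 0 := by
  rw [Matrix.mul_apply]
  simp only [uMat, Matrix.of_apply]
  split_ifs with h
  · obtain ⟨m, rfl⟩ : ∃ m, n = m + 1 := ⟨c, h.symm⟩
    rw [Fin.sum_univ_castSucc, Nat.add_sub_cancel, Finset.sum_range]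
    simp [← ent_val T, h]
  · exact Finset.sum_eq_zero fun k _ => by rw [if_neg (fun h' => h h'.2), mul_zero]

theorem XJ_mul_JS_apply (p : R⟦X⟧) (a c c' : Fin n) (h : c'.val = c.val + 1) :
    (XJ R n * JS n p) a c = X * JS n p a c' := by
  have h1 : (XJ R n * JS n p * JInv n R) a c' = (XJ R n * JS n p) a c := by
    rw [mul_JInv_apply, if_neg (by omega), ent_of_lt _ a.2 (by omega)]
    exact congrArg _ (Fin.ext (by simp; omega))
  rw [← h1, mul_assoc, ← JS_X_mul, XJ_mul_JS_X_mul, Matrix.smul_apply, smul_eq_mul]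

theorem mul_XJ_add_apply_of_lt (T : Matrix (Fin n) (Fin n) R⟦X⟧) (u : ℕ → R) (a c c' : Fin n)
    (h : c'.val = c.val + 1) : (T * (XJ R n + (X : R⟦X⟧) • uMat n u)) a c = X * T a c' := by
  rw [mul_add, Matrix.add_apply, mul_XJ_apply, if_neg (by omega), mul_smul_comm,
    Matrix.smul_apply, mul_uMat_apply, if_neg (by omega), smul_zero, add_zero, zero_add,
    ent_of_lt _ a.2 (by omega)]
  congr
  exact h.symm

theorem isUnit_det_of_unipotent {T : Matrix (Fin n) (Fin n) R⟦X⟧}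
    (h : ∀ i j : Fin n, j < i → coeff 0 (T i j) = 0) (h' : ∀ i, coeff 0 (T i i) = 1) :
    IsUnit T.det := by
  rw [PowerSeries.isUnit_iff_constantCoeff, RingHom.map_det, Matrix.det_of_isUpperTriangular,
    Finset.prod_eq_one]
  · exact isUnit_one
  · exact fun i _ => (coeff_zero_eq_constantCoeff_apply _).symm.trans (h' i)
  · exact fun i j hij => (coeff_zero_eq_constantCoeff_apply _).symm.trans (h i j hij)

end LastColumn

section Dressing

variable {R : Type*} [CommRing R] [Algebra ℝ R] (D : Derivation ℝ R R) {n : ℕ}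

open PowerSeries

variable (n) in
/-- The dressing matrix attached to `f`. -/
def dressMat (f : R⟦X⟧) : Matrix (Fin n) (Fin n) R⟦X⟧ :=
  Matrix.of fun a c => JS n (wave D f c) a c

/-- The dressing equation `T (∂ + J + u) = (∂ + J + f(J⁻¹)) T`, multiplied by `λ⁻¹`. -/
def DressEq (u : Matrix (Fin n) (Fin n) R⟦X⟧) (f : R⟦X⟧) (T : Matrix (Fin n) (Fin n) R⟦X⟧) :
    Prop :=
  T * (XJ R n + (X : R⟦X⟧) • u) - (X : R⟦X⟧) • T.map (psD D) =
    (XJ R n + (X : R⟦X⟧) • JS n f) * T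

variable {D}

/-- If column `c` is `p(J⁻¹) e_c`, applying `∂ + J + f(J⁻¹)` and extracting one factor `J` turns `p`
into the next `wave`. -/
theorem column_step {T : Matrix (Fin n) (Fin n) R⟦X⟧} {f p : R⟦X⟧} {c : Fin n}
    (h : ∀ a, T a c = JS n p a c) (a : Fin n) :
    ((X : R⟦X⟧) • T.map (psD D) + (XJ R n + (X : R⟦X⟧) • JS n f) * T) a c =
      (XJ R n * JS n (X * psD D p + (1 + X * f) * p) : Matrix (Fin n) (Fin n) R⟦X⟧) a c := by
  have h1 : (T.map (psD D)) a c = (JS n (psD D p)) a c := by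
    rw [← map_JS, Matrix.map_apply, Matrix.map_apply, h]
  have h2 : ∀ M : Matrix (Fin n) (Fin n) R⟦X⟧, (M * T) a c = (M * JS n p) a c := by
    intro M
    rw [Matrix.mul_apply, Matrix.mul_apply]
    exact Finset.sum_congr rfl fun k _ => by rw [h]
  have h3 : XJ R n * JS n (X * psD D p + (1 + X * f) * p) = (X : R⟦X⟧) • JS n (psD D p) +
      (XJ R n + (X : R⟦X⟧) • JS n f) * JS n p := by
    rw [add_mul, one_mul, mul_assoc, JS_add, JS_add, mul_add, mul_add, XJ_mul_JS_X_mul,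
      XJ_mul_JS_X_mul, JS_mul f, add_mul, smul_mul_assoc]
  rw [h3, Matrix.add_apply, Matrix.add_apply, h2, Matrix.smul_apply, Matrix.smul_apply, h1]

theorem dressMat_apply_zero (f : R⟦X⟧) (i j : Fin n) (h : j.val = 0) :
    dressMat D n f i j = if i.val = 0 then 1 else 0 := by
  rw [dressMat, Matrix.of_apply, h, wave, JS_one, Matrix.one_apply]
  simp only [Fin.ext_iff, h]

theorem last_column (hn : 2 ≤ n) {T : Matrix (Fin n) (Fin n) R⟦X⟧} (u : ℕ → R) (f : R⟦X⟧)
    (h : T = dressMat D n f) (a c : Fin n) (hc : c.val + 1 = n) :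
    (T * (XJ R n + (X : R⟦X⟧) • uMat n u)) a c =
      (XJ R n * JS n (wave D f n - riccati D n u f)) a c := by
  have h1 : wave D f n - riccati D n u f =
      1 + X * ∑ i ∈ Finset.range (n - 1), C (u i) * (X ^ (n - 1 - i) * wave D f i) := by
    rw [riccati, sub_sub, sub_sub_cancel, Finset.mul_sum]
    congr 1
    refine Finset.sum_congr rfl fun i hi => ?_
    have := Finset.mem_range.1 hi
    rw [show n - i = n - 1 - i + 1 by omega, pow_succ]
    ring
  rw [h1, JS_add, mul_add, mul_add, XJ_mul_JS_X_mul, JS_one, mul_one, Matrix.add_apply,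
    Matrix.add_apply, mul_XJ_apply, if_pos hc, ent_of_le_right _ hc.ge, mul_zero, add_zero,
    mul_smul_comm, Matrix.smul_apply, Matrix.smul_apply, mul_uMat_apply, if_pos hc, JS_sum,
    Matrix.sum_apply, ent_of_lt _ a.2 (by omega)]
  congr 1
  · subst h
    rw [dressMat_apply_zero _ _ _ rfl]
    simp [XJ, e1n, bMat, hc, a.2.ne]
  · congr 1
    refine Finset.sum_congr rfl fun i hi => ?_
    have := Finset.mem_range.1 hi
    rw [JS_C_mul, Matrix.smul_apply, smul_eq_mul, mul_comm, ent_of_lt _ a.2 (by omega),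
      JS_X_pow_mul_apply _ _ a ⟨i, by omega⟩ c (by simp; omega), h]
    rfl

theorem dressEq_dressMat (hn : 2 ≤ n) {u : ℕ → R} {f : R⟦X⟧} (h : riccati D n u f = 0) :
    DressEq D (uMat n u) f (dressMat D n f) := by
  rw [DressEq, sub_eq_iff_eq_add']
  ext1 a c
  rw [column_step (T := dressMat D n f) (p := wave D f c) fun _ => rfl, ← wave_succ]
  by_cases hc : c.val + 1 < n
  · rw [mul_XJ_add_apply_of_lt _ _ a c ⟨c + 1, hc⟩ rfl, XJ_mul_JS_apply _ a c ⟨c + 1, hc⟩ rfl]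
    rfl
  · have hc' : c.val + 1 = n := by omega
    rw [last_column hn u f rfl a c hc', h, sub_zero, hc']

/-- Each column but the last of the equation determines the next column of `T`, so the normalised
first column fixes `T`; the last column is the remaining condition on `f`. -/
theorem eq_dressMat_of_dressEq (hn : 2 ≤ n) {u : ℕ → R} {f : R⟦X⟧}
    {T : Matrix (Fin n) (Fin n) R⟦X⟧}
    (h0 : ∀ i j : Fin n, j.val = 0 → T i j = if i.val = 0 then 1 else 0)
    (h : DressEq D (uMat n u) f T) : T = dressMat D n f ∧ riccati D n u f = 0 := by
  rw [DressEq, sub_eq_iff_eq_add'] at h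
  have hT : T = dressMat D n f := by
    have key : ∀ k (hk : k < n) (a : Fin n), T a ⟨k, hk⟩ = dressMat D n f a ⟨k, hk⟩ := by
      intro k
      induction k with
      | zero =>
        intro hk a
        rw [h0 a _ rfl, dressMat_apply_zero _ _ _ rfl]
      | succ k ih =>
        intro hk a
        have h1 := congrFun (congrFun h a) ⟨k, by omega⟩
        rw [column_step (p := wave D f k) fun a => ih (by omega) a, ← wave_succ,
          mul_XJ_add_apply_of_lt _ _ a ⟨k, by omega⟩ ⟨k + 1, hk⟩ rfl,
          XJ_mul_JS_apply _ a ⟨k, by omega⟩ ⟨k + 1, hk⟩ rfl] at h1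
        exact PowerSeries.X_mul_cancel h1
    ext1 a c
    exact key c c.2 a
  refine ⟨hT, ?_⟩
  let c : Fin n := ⟨n - 1, by omega⟩
  have hc : c.val + 1 = n := by simp only [c]; omega
  refine eq_zero_of_JS_last c hc fun a => ?_
  have h1 : ∀ a, (XJ R n * JS n (riccati D n u f)) a c = 0 := by
    intro a
    have h1 := congrFun (congrFun h a) c
    rw [column_step (T := T) (p := wave D f c) (fun a => by rw [hT]; rfl), ← wave_succ, hc,
      last_column hn u f hT a c hc, JS_sub, mul_sub, Matrix.sub_apply, sub_eq_self] at h1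
    exact h1
  -- Multiplying by `J⁻¹` replaces `λ⁻¹ J` by the scalar `λ⁻¹`, which is cancellable.
  have h2 : (JInv n R * (XJ R n * JS n (riccati D n u f))) a c = 0 := by
    rw [Matrix.mul_apply]
    exact Finset.sum_eq_zero fun k _ => by rw [h1, mul_zero]
  rw [← mul_assoc, JInv_mul_XJ, smul_mul_assoc, one_mul, Matrix.smul_apply, smul_eq_mul] at h2
  exact PowerSeries.X_mul_cancel (h2.trans (mul_zero X).symm)

theorem coeff_zero_dressMat (f : R⟦X⟧) (i j : Fin n) : coeff 0 (dressMat D n f i j) =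
    if i.val ≤ j.val then coeff (j.val - i.val) (wave D f j) else 0 := by
  rw [dressMat, Matrix.of_apply, coeff_JS, mul_zero, add_zero]

theorem coeff_zero_dressMat_of_lt (f : R⟦X⟧) (i j : Fin n) (h : j < i) :
    coeff 0 (dressMat D n f i j) = 0 := by
  rw [coeff_zero_dressMat, if_neg (by simpa using h)]

theorem coeff_zero_dressMat_self (f : R⟦X⟧) (i : Fin n) :
    coeff 0 (dressMat D n f i i) = 1 := by
  rw [coeff_zero_dressMat, if_pos le_rfl, Nat.sub_self, coeff_zero_eq_constantCoeff_apply,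
    constantCoeff_wave]

end Dressing

theorem VLoop_map_C (u : VLoop n) :
    u.1.map PowerSeries.C = uMat n fun i => ent u.1 i (n - 1) := by
  ext1 i j
  rw [Matrix.map_apply, uMat, Matrix.of_apply]
  split_ifs with h
  · rw [ent_of_lt _ i.2 (by omega)]
    exact congrArg (fun k => PowerSeries.C (u.1 i k)) (Fin.ext (by simp; omega))
  · rw [u.2 i j h, map_zero]

theorem conj_sub_eq_iff {A : Type*} [Ring A] {a a' : A} (h : a * a' = 1) (h' : a' * a = 1)
    (b c d : A) : a * b * a' - c * a' = d ↔ a * b - c = d * a := by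
  rw [← sub_mul]
  constructor
  · rintro rfl
    rw [mul_assoc, h', mul_one]
  · intro h2
    rw [h2, mul_assoc, h, mul_one]

/-- Multiplying by the invertible `T` on the right and by `λ⁻¹` removes all positive powers of `λ`,
so the identity can be tested among power series. -/
theorem laurent_dressing_iff {R : Type*} [CommRing R] [Algebra ℝ R] (D : Derivation ℝ R R)
    (u : Matrix (Fin n) (Fin n) R⟦X⟧) (f : R⟦X⟧) {T : Matrix (Fin n) (Fin n) R⟦X⟧}
    (hT : IsUnit T.det) :
    (toLaurent T * (JMat n R + toLaurent u) * (toLaurent T)⁻¹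
      - toLaurent (T.map (psD D)) * (toLaurent T)⁻¹ = JMat n R + toLaurent (JS n f)) ↔
    DressEq D u f T := by
  set ι := HahnSeries.ofPowerSeries ℤ R with hι
  have hL : ∀ M : Matrix (Fin n) (Fin n) R⟦X⟧, toLaurent M = ι.mapMatrix M := fun _ => rfl
  have hdet : IsUnit (toLaurent T).det := by
    rw [hL, ← RingHom.map_det]
    exact hT.map ι
  set x : R⸨X⸩ := HahnSeries.single (1 : ℤ) (1 : R) with hx
  have hιx : ι PowerSeries.X = x := HahnSeries.ofPowerSeries_X
  have hxy : x * HahnSeries.single (-1 : ℤ) (1 : R) = 1 := by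
    rw [hx, HahnSeries.single_mul_single]; simp
  have hsmul : ∀ M : Matrix (Fin n) (Fin n) R⟦X⟧,
      ι.mapMatrix ((PowerSeries.X : R⟦X⟧) • M) = x • ι.mapMatrix M := by
    intro M
    ext1 i j
    simp [hιx]
  have hJ : ι.mapMatrix (XJ R n) = x • JMat n R := by
    rw [XJ, map_add, hsmul, JMat, smul_add, smul_smul, hxy, one_smul]
    congr 1
    · ext1 i j
      simp only [RingHom.mapMatrix_apply, Matrix.map_apply, e1n, Matrix.of_apply]
      split_ifs <;> simp
    · congr 1
      ext1 i j
      simp only [RingHom.mapMatrix_apply, Matrix.map_apply, bMat, Matrix.of_apply]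
      split_ifs <;> simp
  have hinj : Function.Injective (ι.mapMatrix (m := Fin n)) :=
    Matrix.map_injective HahnSeries.ofPowerSeries_injective
  have hxinj : ∀ M N : Matrix (Fin n) (Fin n) R⸨X⸩, x • M = x • N ↔ M = N := by
    refine fun M N => ⟨fun h => ?_, fun h => by rw [h]⟩
    have := congrArg (fun A => (HahnSeries.single (-1 : ℤ) (1 : R)) • A) h
    simpa only [smul_smul, mul_comm _ x, hxy, one_smul] using this
  rw [conj_sub_eq_iff (Matrix.mul_nonsing_inv _ hdet) (Matrix.nonsing_inv_mul _ hdet),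
    DressEq, ← hinj.eq_iff, map_sub, map_mul, map_mul, map_add, map_add, hsmul, hsmul, hsmul,
    hJ, ← smul_add, ← smul_add, smul_mul_assoc, mul_smul_comm, ← smul_sub, hxinj]
  rfl

theorem dressing_eq_iff (u : VLoop n) (f : ℕ → LoopRing)
    {T : Matrix (Fin n) (Fin n) LoopRing⟦X⟧} (hT : IsUnit T.det) :
    (toLaurent T * (JMat n LoopRing + u.1.map HahnSeries.C) * (toLaurent T)⁻¹
      - dxLaurent (toLaurent T) * (toLaurent T)⁻¹ = JMat n LoopRing + toLaurent (JSeries f)) ↔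
    DressEq dx (uMat n fun i => ent u.1 i (n - 1)) (PowerSeries.mk f) T := by
  have hd : dxLaurent (toLaurent T) = toLaurent (T.map (psD dx)) := by
    ext1 i j
    refine HahnSeries.ext (funext fun k => ?_)
    simp only [dxLaurent, toLaurent, Matrix.map_apply, HahnSeries.map_coeff,
      PowerSeries.coeff_coe, coeff_psD]
    split_ifs
    · exact map_zero dx
    · rfl
  have hu : u.1.map HahnSeries.C = toLaurent (uMat n fun i => ent u.1 i (n - 1)) := by
    rw [← VLoop_map_C]
    ext1 i j
    rw [toLaurent, Matrix.map_apply, Matrix.map_apply, Matrix.map_apply,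
      HahnSeries.ofPowerSeries_C]
  rw [hd, hu, ← JS_mk]
  exact laurent_dressing_iff dx _ _ hT

theorem isDressing_iff (hn : 2 ≤ n) (u : VLoop n) (T : Matrix (Fin n) (Fin n) LoopRing⟦X⟧)
    (f : ℕ → LoopRing) : IsDressing u T f ↔ T = dressMat dx n (PowerSeries.mk f) ∧
      riccati dx n (fun i => ent u.1 i (n - 1)) (PowerSeries.mk f) = 0 := by
  constructor
  · rintro ⟨h1, h2, h3, h4⟩
    rw [dressing_eq_iff u f (isUnit_det_of_unipotent h1 h2)] at h4
    exact eq_dressMat_of_dressEq hn h3 h4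
  · rintro ⟨rfl, h⟩
    refine ⟨coeff_zero_dressMat_of_lt _, coeff_zero_dressMat_self _, dressMat_apply_zero _, ?_⟩
    rw [dressing_eq_iff u f
      (isUnit_det_of_unipotent (coeff_zero_dressMat_of_lt _) (coeff_zero_dressMat_self _))]
    exact dressEq_dressMat hn h

theorem existsUnique_isDressing (hn : 2 ≤ n) (u : VLoop n) :
    ∃! p : Matrix (Fin n) (Fin n) LoopRing⟦X⟧ × (ℕ → LoopRing), IsDressing u p.1 p.2 := by
  obtain ⟨f, hf, huniq⟩ := existsUnique_riccati (D := dx) (by omega : 0 < n)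
    fun i => ent u.1 i (n - 1)
  refine ⟨(dressMat dx n (PowerSeries.mk f), f), (isDressing_iff hn u _ _).2 ⟨rfl, hf⟩, ?_⟩
  rintro ⟨T, g⟩ h
  obtain ⟨h1, h2⟩ := (isDressing_iff hn u T g).1 h
  rw [h1, huniq g h2]

theorem riccati_density (hn : 2 ≤ n) (u : VLoop n) :
    riccati dx n (fun i => ent u.1 i (n - 1)) (PowerSeries.mk (density u)) = 0 :=
  ((isDressing_iff hn u _ _).1 (Classical.epsilon_spec (existsUnique_isDressing hn u).exists)).2

theorem density_eq (hn : 2 ≤ n) (u : VLoop n) {f : ℕ → LoopRing}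
    (h : riccati dx n (fun i => ent u.1 i (n - 1)) (PowerSeries.mk f) = 0) : density u = f :=
  (existsUnique_riccati (D := dx) (by omega : 0 < n) fun i => ent u.1 i (n - 1)).unique
    (riccati_density hn u) h

/-! ### Conjugates of powers of `J⁻¹` and variation of the densities. -/

section Coefficients

variable {R : Type*} [CommRing R] {n : ℕ}

open PowerSeries

theorem coeff_zero_mul (g h : R⟦X⟧) : coeff 0 (g * h) = coeff 0 g * coeff 0 h := by
  simp only [coeff_zero_eq_constantCoeff_apply, map_mul]

theorem JInv_pow_commute (m : ℕ) (f : R⟦X⟧) :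
    JInv n R ^ m * (XJ R n + (X : R⟦X⟧) • JS n f) =
      (XJ R n + (X : R⟦X⟧) • JS n f) * JInv n R ^ m := by
  have h1 : Commute (JInv n R) (XJ R n) := JInv_mul_XJ.trans XJ_mul_JInv.symm
  have h2 : Commute (JInv n R) (JS n f) := by
    rw [← JS_X]
    exact JS_comm _ _
  exact ((h1.add_right (h2.smul_right X)).pow_left m).eq

theorem coeff_one_trace_JInv_pow_mul_JS {m : ℕ} (hm : m ≤ n) (g : R⟦X⟧) :
    coeff 1 (JInv n R ^ m * JS n g).trace = n • coeff (n - m) g := by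
  rw [← JS_X_pow, ← JS_mul, Matrix.trace, map_sum, Finset.sum_congr rfl fun a _ => by
    rw [Matrix.diag_apply, coeff_JS, if_pos (by omega), mul_one, Nat.add_sub_cancel_left,
      coeff_X_pow_mul', if_pos hm]]
  simp

theorem map_coeff_mul_map_C (M : Matrix (Fin n) (Fin n) R⟦X⟧) (A : Matrix (Fin n) (Fin n) R)
    (k : ℕ) : (M * A.map C).map (coeff k) = M.map (coeff k) * A := by
  ext1 i j
  simp only [Matrix.map_apply, Matrix.mul_apply, map_sum, coeff_mul_C]

theorem map_coeff_map_C_mul (M : Matrix (Fin n) (Fin n) R⟦X⟧) (A : Matrix (Fin n) (Fin n) R)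
    (k : ℕ) : (A.map C * M).map (coeff k) = A * M.map (coeff k) := by
  ext1 i j
  simp only [Matrix.map_apply, Matrix.mul_apply, map_sum, coeff_C_mul]

end Coefficients

section Variation

variable {R : Type*} [CommRing R] [Algebra ℝ R] {D δ : Derivation ℝ R R} {n : ℕ}

open PowerSeries

theorem map_psD_smul_X (D : Derivation ℝ R R) (M : Matrix (Fin n) (Fin n) R⟦X⟧) :
    ((X : R⟦X⟧) • M).map (psD D) = (X : R⟦X⟧) • M.map (psD D) := by
  ext1 i j
  have := psD_X_pow_mul D 1 (M i j)
  rwa [pow_one] at this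

theorem map_psD_JInv_pow (D : Derivation ℝ R R) (m : ℕ) :
    (JInv n R ^ m).map (psD D) = 0 := by
  have h : psD D ((X : R⟦X⟧) ^ m) = 0 := by
    rw [← mul_one ((X : R⟦X⟧) ^ m), psD_X_pow_mul, Derivation.map_one_eq_zero, mul_zero]
  rw [← JS_X_pow, map_JS, h]
  exact map_zero (JSHom R n)

theorem map_psD_XJ (D : Derivation ℝ R R) : (XJ R n).map (psD D) = 0 := by
  have h : psD D (X : R⟦X⟧) = 0 := by
    rw [← mul_one (X : R⟦X⟧), ← pow_one (X : R⟦X⟧), psD_X_pow_mul, Derivation.map_one_eq_zero,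
      mul_zero]
  ext1 i j
  simp only [XJ, Matrix.map_apply, Matrix.add_apply, Matrix.smul_apply, e1n, bMat,
    Matrix.of_apply, smul_eq_mul, Matrix.zero_apply, map_add]
  split_ifs <;> simp [h]

/-- Undressing: a constant `Z` commuting with `J + f(J⁻¹)` becomes `M = T⁻¹ Z T`, which commutes
with `∂ + J + u`. -/
theorem DressEq.conj_commute {u : Matrix (Fin n) (Fin n) R⟦X⟧} {f : R⟦X⟧}
    {T M Z : Matrix (Fin n) (Fin n) R⟦X⟧} (h : DressEq D u f T) (hT : IsUnit T.det)
    (hM : T * M = Z * T) (hZ : Z.map (psD D) = 0)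
    (hZf : Z * (XJ R n + (X : R⟦X⟧) • JS n f) = (XJ R n + (X : R⟦X⟧) • JS n f) * Z) :
    (X : R⟦X⟧) • M.map (psD D) + ((XJ R n + (X : R⟦X⟧) • u) * M - M * (XJ R n + (X : R⟦X⟧) • u))
      = 0 := by
  rw [DressEq, sub_eq_iff_eq_add'] at h
  generalize XJ R n + (X : R⟦X⟧) • JS n f = B at *
  generalize XJ R n + (X : R⟦X⟧) • u = A at *
  have h1 := congrArg (fun N => N.map (psD D)) hM
  simp only [map_mul_derivation, hZ, zero_mul, zero_add] at h1
  have h2 : T * ((X : R⟦X⟧) • M.map (psD D) + (A * M - M * A)) = 0 := by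
    have h3 : T * ((X : R⟦X⟧) • M.map (psD D)) = Z * ((X : R⟦X⟧) • T.map (psD D)) -
        ((X : R⟦X⟧) • T.map (psD D)) * M := by
      rw [mul_smul_comm, mul_smul_comm, smul_mul_assoc, ← h1, ← smul_sub, add_sub_cancel_left]
    have h4 : (X : R⟦X⟧) • T.map (psD D) = T * A - B * T := by rw [h]; abel
    rw [mul_add, mul_sub, h3, h4, mul_sub, sub_mul, ← mul_assoc T M A, hM, ← mul_assoc Z B T, hZf,
      mul_assoc B T M, hM]
    simp only [mul_assoc]
    abel
  have h5 := congrArg (fun N => T⁻¹ * N) h2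
  simpa only [← mul_assoc, Matrix.nonsing_inv_mul _ hT, one_mul, mul_zero] using h5

/-- With `S = δT · T⁻¹`, varying the dressing equation gives `T δu T⁻¹ = ∂S + δf(J⁻¹) + [J + f(J⁻¹),
S]`. The trace against `Z` removes the commutator and makes the `∂S` term a total derivative. -/
theorem DressEq.trace_variation {u : Matrix (Fin n) (Fin n) R⟦X⟧} {f : R⟦X⟧}
    {T Z : Matrix (Fin n) (Fin n) R⟦X⟧} (h : DressEq D u f T) (hT : IsUnit T.det)
    (hDδ : ∀ r, D (δ r) = δ (D r)) (hZ : Z.map (psD D) = 0)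
    (hZf : Z * (XJ R n + (X : R⟦X⟧) • JS n f) = (XJ R n + (X : R⟦X⟧) • JS n f) * Z) :
    (Z * JS n (psD δ f)).trace = (T⁻¹ * Z * T * u.map (psD δ)).trace -
      psD D (Z * (T.map (psD δ) * T⁻¹)).trace := by
  have hcomm : (T.map (psD D)).map (psD δ) = (T.map (psD δ)).map (psD D) := by
    ext i j k
    simp only [Matrix.map_apply, coeff_psD, hDδ]
  have hadd : ∀ M N : Matrix (Fin n) (Fin n) R⟦X⟧,
      (M + N).map (psD δ) = M.map (psD δ) + N.map (psD δ) :=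
    Matrix.map_add _ (map_add (psD δ))
  have h' := h
  rw [DressEq, sub_eq_iff_eq_add'] at h h'
  have h1 := congrArg (fun N => N.map (psD δ)) h
  simp only [map_mul_derivation, hadd, map_psD_smul_X, map_psD_XJ, zero_add, map_JS, hcomm] at h1
  set T' := T.map (psD δ)
  set G := JS n (psD δ f)
  set V := u.map (psD δ)
  generalize XJ R n + (X : R⟦X⟧) • JS n f = B at *
  generalize XJ R n + (X : R⟦X⟧) • u = A at *
  have hi : T⁻¹ * T = 1 := Matrix.nonsing_inv_mul _ hT
  have hi' : T * T⁻¹ = 1 := Matrix.mul_nonsing_inv _ hT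
  set S := T' * T⁻¹ with hS
  have hST : T' = S * T := by rw [hS, mul_assoc, hi, mul_one]
  have h2 : T'.map (psD D) = S.map (psD D) * T + S * T.map (psD D) := by
    conv_lhs => rw [hST, map_mul_derivation]
  -- the equation for `S`
  have h3 : (X : R⟦X⟧) • (T * V * T⁻¹) = (X : R⟦X⟧) • S.map (psD D) + (X : R⟦X⟧) • G
      + (B * S - S * B) := by
    have h4 : S * (T * A) = S * ((X : R⟦X⟧) • T.map (psD D)) + S * (B * T) := by rw [h, mul_add]
    rw [h2, hST, mul_assoc S T A, h4] at h1
    have h5 : (X : R⟦X⟧) • (T * V) = ((X : R⟦X⟧) • S.map (psD D) + (X : R⟦X⟧) • G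
      + (B * S - S * B)) * T := by
      simp only [add_mul, sub_mul, smul_mul_assoc, mul_smul_comm, smul_add, mul_assoc] at h1 ⊢
      rw [← sub_eq_zero] at h1 ⊢
      rw [← h1]
      abel
    rw [← smul_mul_assoc, h5, mul_assoc, hi', mul_one]
  have h6 := congrArg (fun N => (Z * N).trace) h3
  simp only [mul_add, mul_sub, Matrix.trace_add, Matrix.trace_sub, mul_smul_comm,
    Matrix.trace_smul] at h6
  have h7 : (Z * (B * S)).trace = (Z * (S * B)).trace := by
    rw [← mul_assoc, hZf, mul_assoc, Matrix.trace_mul_comm, mul_assoc]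
  have h8 : (T⁻¹ * Z * T * V).trace = (Z * (T * V * T⁻¹)).trace := by
    rw [mul_assoc T⁻¹, mul_assoc T⁻¹, Matrix.trace_mul_comm]
    simp only [mul_assoc]
  have h9 : psD D (Z * S).trace = (Z * S.map (psD D)).trace := by
    rw [← trace_map_derivation, map_mul_derivation, hZ, zero_mul, zero_add]
  rw [h7, sub_self, add_zero, ← smul_add, smul_eq_mul, smul_eq_mul] at h6
  rw [h8, h9, PowerSeries.X_mul_cancel h6]
  ring

variable (D) in
/-- The matrix `T⁻¹ J⁻ᵐ T`. -/
def conjMat (n : ℕ) (f : R⟦X⟧) (m : ℕ) : Matrix (Fin n) (Fin n) R⟦X⟧ :=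
  (dressMat D n f)⁻¹ * JInv n R ^ m * dressMat D n f

theorem isUnit_det_dressMat (f : R⟦X⟧) : IsUnit (dressMat D n f).det :=
  isUnit_det_of_unipotent (coeff_zero_dressMat_of_lt f) (coeff_zero_dressMat_self f)

theorem dressMat_mul_conjMat (f : R⟦X⟧) (m : ℕ) :
    dressMat D n f * conjMat D n f m = JInv n R ^ m * dressMat D n f := by
  rw [conjMat, mul_assoc _⁻¹, ← mul_assoc, Matrix.mul_nonsing_inv _ (isUnit_det_dressMat f),
    one_mul]

theorem coeff_zero_JInv_pow_mul_dressMat {f : R⟦X⟧} {m : ℕ} (l c : Fin n) (hc : c.val < m) :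
    coeff 0 ((JInv n R ^ m * dressMat D n f) l c) = 0 := by
  rw [Matrix.mul_apply, map_sum]
  refine Finset.sum_eq_zero fun k _ => ?_
  rw [coeff_zero_mul, coeff_JInv_pow_eq]
  split_ifs with h
  · rw [coeff_zero_dressMat_of_lt _ _ _ (Fin.lt_def.2 (by omega)), mul_zero]
  · rw [zero_mul]

theorem coeff_zero_conjMat_of_lt {f : R⟦X⟧} {m : ℕ} (k c : Fin n) (hc : c.val < m) :
    coeff 0 (conjMat D n f m k c) = 0 := by
  rw [conjMat, mul_assoc, Matrix.mul_apply, map_sum]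
  refine Finset.sum_eq_zero fun l _ => ?_
  rw [coeff_zero_mul, coeff_zero_JInv_pow_mul_dressMat _ _ hc, mul_zero]

theorem coeff_zero_dressMat_last {f : R⟦X⟧} (i k : Fin n) (hi : i.val + 1 = n) :
    coeff 0 (dressMat D n f i k) = if k = i then 1 else 0 := by
  split_ifs with h
  · rw [h, coeff_zero_dressMat_self]
  · have : k.val ≠ i.val := fun h' => h (Fin.ext h')
    exact coeff_zero_dressMat_of_lt _ _ _ (Fin.lt_def.2 (by omega))

/-- At order zero the last row of `T` is that of the identity, while the last row of `J⁻ᵐ` is zero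
for `m > 0`. -/
theorem coeff_zero_conjMat_last {f : R⟦X⟧} {m : ℕ} (hm : 0 < m) (i c : Fin n)
    (hi : i.val + 1 = n) : coeff 0 (conjMat D n f m i c) = 0 := by
  have h := congrArg (coeff 0) (congrFun (congrFun (dressMat_mul_conjMat (D := D) f m) i) c)
  simp only [Matrix.mul_apply, map_sum, coeff_zero_mul, coeff_zero_dressMat_last i _ hi,
    coeff_JInv_pow_eq, ite_mul, one_mul, zero_mul, Finset.sum_ite_eq', Finset.mem_univ,
    if_true] at h
  rw [h]
  exact Finset.sum_eq_zero fun k _ => if_neg (by omega)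

/-- At order one the last row of `J⁻ᵐ` has its single entry in column `m - 1`, so it picks row `m -
1` of the unipotent `T_0`. The term `T_1 R_0` drops out because the first `m` columns of `R_0`
vanish. -/
theorem coeff_one_conjMat_last {f : R⟦X⟧} {m : ℕ} (hm : m < n) (i c : Fin n)
    (hi : i.val + 1 = n) (hc : c.val < m) :
    coeff 1 (conjMat D n f m i c) = if c.val + 1 = m then 1 else 0 := by
  have h := congrArg (coeff 1) (congrFun (congrFun (dressMat_mul_conjMat (D := D) f m) i) c)
  simp only [Matrix.mul_apply, map_sum, coeff_one_mul, ← coeff_zero_eq_constantCoeff_apply,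
    coeff_zero_dressMat_last i _ hi,
    coeff_zero_conjMat_of_lt _ c hc, mul_zero, zero_add,
    coeff_JInv_pow_eq, ite_mul, mul_ite, mul_one, one_mul, zero_mul, Finset.sum_ite_eq', Finset.mem_univ,
    if_true] at h
  rw [h, Finset.sum_eq_single ⟨m - 1, by omega⟩, if_pos (by simp; omega), if_neg (by simp; omega),
    add_zero]
  · split_ifs with h1
    · rw [show (⟨m - 1, by omega⟩ : Fin n) = c from Fin.ext (by simp; omega),
        coeff_zero_dressMat_self]
    · exact coeff_zero_dressMat_of_lt _ _ _ (Fin.lt_def.2 (by simp; omega))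
  · intro k _ hk
    rw [if_neg fun h1 => hk (Fin.ext (by simp; omega)), if_neg (by omega), add_zero]
  · simp

theorem map_dressMat {S : Type*} [CommRing S] [Algebra ℝ S] {D' : Derivation ℝ S S}
    (φ : R →+* S) (hφ : ∀ r, φ (D r) = D' (φ r)) (f : R⟦X⟧) :
    (dressMat D n f).map (PowerSeries.map φ) = dressMat D' n (PowerSeries.map φ f) := by
  ext1 a c
  rw [dressMat, dressMat, Matrix.of_apply, ← map_wave φ hφ, ← map_JS_ringHom]
  rfl

theorem map_conjMat {S : Type*} [CommRing S] [Algebra ℝ S] {D' : Derivation ℝ S S}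
    (φ : R →+* S) (hφ : ∀ r, φ (D r) = D' (φ r)) (f : R⟦X⟧) (m : ℕ) :
    (conjMat D n f m).map (PowerSeries.map φ) = conjMat D' n (PowerSeries.map φ f) m := by
  have h := congrArg (PowerSeries.map φ).mapMatrix (dressMat_mul_conjMat (D := D) (n := n) f m)
  rw [map_mul, map_mul] at h
  have hK : (PowerSeries.map φ).mapMatrix (JInv n R ^ m) = JInv n S ^ m := by
    rw [← JS_X_pow, ← JS_X_pow, RingHom.mapMatrix_apply, map_JS_ringHom, map_pow,
      PowerSeries.map_X]
  rw [hK, RingHom.mapMatrix_apply, RingHom.mapMatrix_apply, map_dressMat φ hφ,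
    ← dressMat_mul_conjMat] at h
  have h5 := congrArg (fun N => (dressMat D' n (PowerSeries.map φ f))⁻¹ * N) h
  simpa only [← mul_assoc, Matrix.nonsing_inv_mul _ (isUnit_det_dressMat _), one_mul] using h5

theorem conjMat_commute (hn : 2 ≤ n) {u : ℕ → R} {f : R⟦X⟧} (h : riccati D n u f = 0) (m : ℕ) :
    (X : R⟦X⟧) • (conjMat D n f m).map (psD D) +
      ((XJ R n + (X : R⟦X⟧) • uMat n u) * conjMat D n f m -
        conjMat D n f m * (XJ R n + (X : R⟦X⟧) • uMat n u)) = 0 :=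
  (dressEq_dressMat hn h).conj_commute (isUnit_det_dressMat f) (dressMat_mul_conjMat f m)
    (map_psD_JInv_pow D m) (JInv_pow_commute m f)

theorem trace_variation (hn : 2 ≤ n) {u : ℕ → R} {f : R⟦X⟧} (h : riccati D n u f = 0)
    (hDδ : ∀ r, D (δ r) = δ (D r)) (m : ℕ) :
    ∃ g : R⟦X⟧, (JInv n R ^ m * JS n (psD δ f)).trace =
      (conjMat D n f m * (uMat n u).map (psD δ)).trace - psD D g :=
  ⟨_, (dressEq_dressMat hn h).trace_variation (isUnit_det_dressMat f) hDδ
    (map_psD_JInv_pow D m) (JInv_pow_commute m f)⟩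

end Variation

theorem psD_C {R : Type*} [CommRing R] [Algebra ℝ R] (D : Derivation ℝ R R) (r : R) :
    psD D (PowerSeries.C r) = PowerSeries.C (D r) := by
  ext k
  rw [coeff_psD, PowerSeries.coeff_C, PowerSeries.coeff_C]
  split_ifs <;> simp

/-! ### Polynomial deformations and the gradients of the Hamiltonians. -/

section PolyD

variable {R : Type*} [CommRing R] [Algebra ℝ R] (D : Derivation ℝ R R)

/-- A derivation applied to the coefficients of a polynomial. -/
def polyD : Derivation ℝ (Polynomial R) (Polynomial R) :=
  Derivation.mk'
    { toFun := fun p => PolynomialModule.equivPolynomialSelf (D.mapCoeffs p)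
      map_add' := fun p q => by rw [map_add, map_add]
      map_smul' := fun c p => by
        rw [Derivation.map_smul]
        rfl }
    (fun p q => by
      change PolynomialModule.equivPolynomialSelf (D.mapCoeffs (p * q)) = _
      rw [Derivation.leibniz, map_add, map_smul, map_smul]
      rfl)

theorem coeff_polyD (p : Polynomial R) (k : ℕ) : (polyD D p).coeff k = D (p.coeff k) := rfl

theorem derivation_algebraMap_mul (s : ℝ) (r : R) :
    D (algebraMap ℝ R s * r) = algebraMap ℝ R s * D r := by
  rw [← Algebra.smul_def, ← Algebra.smul_def, Derivation.map_smul]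

theorem eval_polyD (s : ℝ) (p : Polynomial R) :
    (polyD D p).eval (algebraMap ℝ R s) = D (p.eval (algebraMap ℝ R s)) := by
  induction p using Polynomial.induction_on' with
  | add p q hp hq => rw [map_add, Polynomial.eval_add, Polynomial.eval_add, hp, hq, map_add]
  | monomial k a =>
    have h : polyD D (Polynomial.monomial k a) = Polynomial.monomial k (D a) := by
      ext l
      rw [coeff_polyD, Polynomial.coeff_monomial, Polynomial.coeff_monomial]
      split_ifs <;> simp
    rw [h, Polynomial.eval_monomial, Polynomial.eval_monomial, ← map_pow, mul_comm, mul_comm a,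
      derivation_algebraMap_mul]

variable (R) in
/-- The derivative of polynomials, as a real derivation. -/
def derivPoly : Derivation ℝ (Polynomial R) (Polynomial R) :=
  Polynomial.derivative'.restrictScalars ℝ

theorem derivPoly_apply (p : Polynomial R) : derivPoly R p = Polynomial.derivative p := rfl

theorem polyD_derivPoly (p : Polynomial R) :
    polyD D (derivPoly R p) = derivPoly R (polyD D p) := by
  ext k
  rw [coeff_polyD, derivPoly_apply, derivPoly_apply, Polynomial.coeff_derivative,
    Polynomial.coeff_derivative, coeff_polyD, mul_comm, mul_comm (D _)]
  have h := derivation_algebraMap_mul D ((k : ℝ) + 1) (p.coeff (k + 1))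
  rw [map_add, map_one, map_natCast] at h
  exact h

end PolyD

theorem hasDerivAt_circInt_eval (p : Polynomial LoopRing) :
    HasDerivAt (fun s : ℝ => circInt (p.eval (algebraMap ℝ LoopRing s)))
      (circInt (p.coeff 1)) 0 := by
  induction p using Polynomial.induction_on' with
  | add p q hp hq =>
    simp only [Polynomial.eval_add, Polynomial.coeff_add, circInt_add]
    exact hp.fun_add hq
  | monomial k a =>
    have h1 : ∀ s : ℝ, circInt ((Polynomial.monomial k a).eval (algebraMap ℝ LoopRing s)) =
        s ^ k * circInt a := by
      intro s
      rw [Polynomial.eval_monomial, ← map_pow, mul_comm, ← Algebra.smul_def, circInt_smul]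
    simp only [h1]
    have h2 := (hasDerivAt_pow k (0 : ℝ)).mul_const (circInt a)
    refine h2.congr_deriv ?_
    rw [Polynomial.coeff_monomial]
    rcases k with _ | _ | k <;> simp [circInt_zero]

/-- The matrix `T⁻¹ J⁻ᵐ T` for the dressing matrix `T` of `u`. -/
def resMat (u : VLoop n) (m : ℕ) : Matrix (Fin n) (Fin n) LoopRing⟦X⟧ :=
  conjMat dx n (PowerSeries.mk (density u)) m

theorem piZero_mem (y : LoopMat n) : piZero y ∈ VtLoop n := fun _ _ h => if_neg h

/-- The gradient of `H_j`. -/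
def gradH (u : VLoop n) (j : ℕ) : VtLoop n :=
  ⟨piZero ((resMat u (n - j)).map (PowerSeries.coeff 1)), piZero_mem _⟩

theorem piZero_piZero (y : LoopMat n) : piZero (piZero y) = piZero y :=
  piZero_of_mem (piZero_mem y)

/-- The densities of `u + s v` are polynomials in `s`: the Riccati equation is solved over
`LoopRing[s]`, and uniqueness identifies evaluations of that solution with the actual densities.
Differentiation in `s` is thus algebraic. -/
theorem isGradient_gradH (hn : 2 ≤ n) (u : VLoop n) {j : ℕ} (hj : j ≤ n) :
    IsGradient (H n j) u (gradH u j) := by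
  intro v
  let U : ℕ → Polynomial LoopRing := fun i =>
    Polynomial.C (ent u.1 i (n - 1)) + Polynomial.X * Polynomial.C (ent v.1 i (n - 1))
  obtain ⟨f, hf, -⟩ := existsUnique_riccati (D := polyD dx) (by omega : 0 < n) U
  have hφ : ∀ (s : ℝ) r, Polynomial.evalRingHom (algebraMap ℝ LoopRing s) (polyD dx r) =
      dx (Polynomial.evalRingHom (algebraMap ℝ LoopRing s) r) := eval_polyD dx
  have hdens : ∀ s : ℝ, density (u + s • v) =
      fun i => (f i).eval (algebraMap ℝ LoopRing s) := by
    intro s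
    refine density_eq hn _ ?_
    have h1 := map_riccati _ (hφ s) n U (PowerSeries.mk f)
    rw [show riccati (polyD dx) n U (PowerSeries.mk f) = 0 from hf, map_zero] at h1
    have h2 : (fun i => Polynomial.evalRingHom (algebraMap ℝ LoopRing s) (U i)) =
        fun i => ent (u + s • v).1 i (n - 1) := by
      funext i
      have h3 : ent (u + s • v).1 i (n - 1) = ent u.1 i (n - 1) + s • ent v.1 i (n - 1) := by
        simp only [ent]
        split_ifs
        · rfl
        · simp
      rw [h3, Algebra.smul_def]
      simp only [U, map_add, map_mul, Polynomial.coe_evalRingHom, Polynomial.eval_C,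
        Polynomial.eval_X]
    have h4 : PowerSeries.map (Polynomial.evalRingHom (algebraMap ℝ LoopRing s))
        (PowerSeries.mk f) = PowerSeries.mk fun i => (f i).eval (algebraMap ℝ LoopRing s) := by
      ext1 k
      simp
    rw [← h2, ← h4, ← h1]
  have hH : (fun s : ℝ => H n j (u + s • v)) =
      fun s => n * circInt ((f j).eval (algebraMap ℝ LoopRing s)) := by
    funext s
    rw [H, hdens]
  rw [hH]
  refine ((hasDerivAt_circInt_eval (f j)).const_mul (n : ℝ)).congr_deriv ?_
  let φ := Polynomial.evalRingHom (0 : LoopRing)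
  have hφ0 : ∀ r, φ (polyD dx r) = dx (φ r) := by
    have := hφ 0
    rwa [map_zero] at this
  -- With exponent `n - j`, the `λ⁻¹` coefficient of the trace isolates `n` times the variation of
  -- `f_j`.
  obtain ⟨g, hg⟩ := trace_variation hn hf (δ := derivPoly LoopRing) (polyD_derivPoly dx) (n - j)
  have h1 := congrArg φ ((coeff_one_trace_JInv_pow_mul_JS (by omega) _).symm.trans
    (congrArg (PowerSeries.coeff 1) hg))
  have hU : (uMat n U).map (psD (derivPoly LoopRing)) =
      (v.1.map Polynomial.C).map PowerSeries.C := by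
    ext1 i k
    rw [Matrix.map_apply, Matrix.map_apply, Matrix.map_apply, uMat, Matrix.of_apply]
    split_ifs with h
    · rw [psD_C, show k = ⟨n - 1, by omega⟩ from Fin.ext (by simp; omega)]
      congr 1
      simp [U, derivPoly_apply, ent_of_lt _ i.2 (show n - 1 < n by omega)]
    · rw [v.2 i k h, map_zero, map_zero, map_zero]
  have hM : (conjMat (polyD dx) n (PowerSeries.mk f) (n - j)).map (PowerSeries.map φ) =
      resMat u (n - j) := by
    rw [map_conjMat (D := polyD dx) (D' := dx) φ hφ0, resMat]
    congr 1
    have h2 := hdens 0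
    rw [zero_smul, add_zero, map_zero] at h2
    ext1 k
    simp [h2, φ]
  have h2 : φ (PowerSeries.coeff 1 (conjMat (polyD dx) n (PowerSeries.mk f) (n - j) *
      (uMat n U).map (psD (derivPoly LoopRing))).trace) =
      ((resMat u (n - j)).map (PowerSeries.coeff 1) * v.1).trace := by
    have h3 : ((resMat u (n - j)).map (PowerSeries.coeff 1)) =
        ((conjMat (polyD dx) n (PowerSeries.mk f) (n - j)).map (PowerSeries.coeff 1)).map φ := by
      rw [← hM]
      ext1 a b
      simp
    have h4 : v.1 = (v.1.map Polynomial.C).map φ := by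
      ext1 a b
      simp [φ]
    rw [hU, h3]
    conv_rhs => rw [h4]
    rw [← Matrix.map_mul, ← map_coeff_mul_map_C]
    simp [Matrix.trace, map_sum]
  rw [map_sub, map_sub, h2, coeff_psD, coeff_psD, hφ0,
    show n - (n - j) = j by omega, PowerSeries.coeff_mk, derivPoly_apply, map_nsmul,
    Polynomial.coe_evalRingHom, ← Polynomial.coeff_zero_eq_eval_zero,
    Polynomial.coeff_derivative] at h1
  -- Integration over the circle discards the total derivative of `g`.
  have h5 := congrArg circInt h1
  rw [circInt_sub, circInt_dx, sub_zero, ← Nat.cast_smul_eq_nsmul ℝ, circInt_smul] at h5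
  have h6 : pairing (gradH u j).1 v.1 =
      pairing ((resMat u (n - j)).map (PowerSeries.coeff 1)) v.1 := by
    rw [pairing_comm, pairing_comm _ v.1]
    exact pairing_eq_of_piZero_eq v.2 (piZero_piZero _)
  rw [h6, pairing, ← h5]
  simp

theorem existsUnique_isGradient_H (hn : 2 ≤ n) (u : VLoop n) {j : ℕ} (hj : j ≤ n) :
    ∃! ξ, IsGradient (H n j) u ξ :=
  ⟨_, isGradient_gradH hn u hj, fun _ hξ => VtLoop_ext_pairing fun v =>
    (hξ v).unique (isGradient_gradH hn u hj v)⟩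

theorem gradient_H (hn : 2 ≤ n) (u : VLoop n) {j : ℕ} (hj : j ≤ n) :
    gradient (H n j) u = gradH u j :=
  (existsUnique_isGradient_H hn u hj).unique
    (Classical.epsilon_spec (existsUnique_isGradient_H hn u hj).exists) (isGradient_gradH hn u hj)

/-! ### The Casimir property and the kernel. -/

/-- Compare coefficients of `λ^{-k}` in the vanishing commutator with `∂ + J + u`. -/
theorem covDeriv_resMat (hn : 2 ≤ n) (u : VLoop n) (m k : ℕ) :
    covDeriv u.1 ((resMat u m).map (PowerSeries.coeff k)) =
      -(e1n n LoopRing * (resMat u m).map (PowerSeries.coeff (k + 1)) -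
        (resMat u m).map (PowerSeries.coeff (k + 1)) * e1n n LoopRing) := by
  have h := conjMat_commute (D := dx) hn (riccati_density hn u) m
  have hA : XJ LoopRing n + (PowerSeries.X : LoopRing⟦X⟧) • uMat n (fun i => ent u.1 i (n - 1)) =
      (e1n n LoopRing).map PowerSeries.C +
        (PowerSeries.X : LoopRing⟦X⟧) • (bMat n LoopRing + u.1).map PowerSeries.C := by
    have h1 : (e1n n LoopRing).map PowerSeries.C = e1n n LoopRing⟦X⟧ := by
      ext1 i j
      simp only [e1n, Matrix.map_apply, Matrix.of_apply]
      split_ifs <;> simp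
    have h2 : (bMat n LoopRing).map PowerSeries.C = bMat n LoopRing⟦X⟧ := by
      ext1 i j
      simp only [bMat, Matrix.map_apply, Matrix.of_apply]
      split_ifs <;> simp
    rw [Matrix.map_add _ (map_add PowerSeries.C), VLoop_map_C, h1, h2, XJ, smul_add, add_assoc]
  rw [hA, ← resMat] at h
  have h3 : ∀ M : Matrix (Fin n) (Fin n) LoopRing⟦X⟧,
      ((PowerSeries.X : LoopRing⟦X⟧) • M).map (PowerSeries.coeff (k + 1)) =
        M.map (PowerSeries.coeff k) := by
    intro M
    ext1 i j
    exact PowerSeries.coeff_succ_X_mul _ _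
  have hadd : ∀ M N : Matrix (Fin n) (Fin n) LoopRing⟦X⟧,
      (M + N).map (PowerSeries.coeff (k + 1)) =
        M.map (PowerSeries.coeff (k + 1)) + N.map (PowerSeries.coeff (k + 1)) :=
    Matrix.map_add _ (map_add _)
  have hsub : ∀ M N : Matrix (Fin n) (Fin n) LoopRing⟦X⟧,
      (M - N).map (PowerSeries.coeff (k + 1)) =
        M.map (PowerSeries.coeff (k + 1)) - N.map (PowerSeries.coeff (k + 1)) :=
    Matrix.map_sub _ (map_sub _)
  have h4 := congrArg (fun M => M.map (PowerSeries.coeff (k + 1))) h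
  simp only [add_mul _ _ (resMat u m), mul_add (resMat u m), smul_mul_assoc, mul_smul_comm,
    hadd, hsub, h3, map_coeff_mul_map_C, map_coeff_map_C_mul] at h4
  have h5 : ((resMat u m).map (psD dx)).map (PowerSeries.coeff k) =
      ((resMat u m).map (PowerSeries.coeff k)).map dx := by
    ext1 i j
    simp only [Matrix.map_apply, coeff_psD]
  rw [h5, show (0 : Matrix (Fin n) (Fin n) LoopRing⟦X⟧).map (PowerSeries.coeff (k + 1)) = 0 from
    Matrix.map_zero _ (map_zero _)] at h4
  rw [covDeriv, ← add_eq_zero_iff_eq_neg, ← h4]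
  abel

/-- Both parts of `W(η)` are paired with `R_1`. The `linP` part moves to `R_2` and dies since `linP`
commutes with `e_{1n}`. The `P_u(η)` part moves to `R_0`, whose last row is zero; this needs `n - j
> 0`. -/
theorem form₁_gradH (hn : 2 ≤ n) (u : VLoop n) {j : ℕ} (hj : j < n) (η : VtLoop n) :
    form₁ u (gradH u j) η = 0 := by
  have h0 : piZero ((resMat u (n - j)).map (PowerSeries.coeff 0)) = piZero 0 := by
    ext1 a c
    simp only [piZero, Matrix.of_apply, Matrix.map_apply]
    split_ifs with h
    · exact coeff_zero_conjMat_last (by omega) a c h.1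
    · rfl
  have h1 : pairing (W u η) (gradH u j).1 =
      pairing (W u η) ((resMat u (n - j)).map (PowerSeries.coeff 1)) :=
    pairing_eq_of_piZero_eq (W_mem hn u η) (piZero_piZero _)
  have h2 : pairing (covDeriv u.1 (linP u η)) ((resMat u (n - j)).map (PowerSeries.coeff 1)) =
      0 := by
    rw [pairing_covDeriv, covDeriv_resMat hn, pairing_comm, pairing_neg_left, pairing_commutator,
      commutator_e1n_linP, pairing_comm, pairing_zero_left]
    simp
  have h3 : pairing (e1n n LoopRing * P u η - P u η * e1n n LoopRing)
      ((resMat u (n - j)).map (PowerSeries.coeff 1)) = 0 := by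
    rw [pairing_commutator, pairing_comm, ← pairing_neg_left, ← covDeriv_resMat hn,
      pairing_covDeriv, pairing_comm, pairing_eq_of_piZero_eq (isP_P hn u η).2.2 h0, pairing_comm,
      pairing_zero_left, neg_zero]
  rw [form₁_antisymm, ← pairing_W hn, h1, W, pairing_add_left, h2, h3, add_zero, neg_zero]

theorem ent_gradH (u : VLoop n) {m : ℕ} (hm : m < n - 1) (c : ℕ) (hc : c ≤ m) :
    ent (gradH u (n - 1 - m)).1 (n - 1) c = if c = m then 1 else 0 := by
  rw [ent_of_lt _ (by omega) (by omega)]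
  simp only [gradH, piZero, Matrix.of_apply]
  rw [if_pos ⟨by omega, by omega⟩, Matrix.map_apply, resMat,
    coeff_one_conjMat_last (by omega) _ _ (by simp; omega) (by simp; omega)]
  simp only
  split_ifs <;> first | rfl | (exfalso; omega)

theorem mem_span_gradH (hn : 2 ≤ n) (u : VLoop n) (k : ℕ) (hk : k ≤ n - 1) (ξ : VtLoop n)
    (h : ξ ∈ kerJ₁ hn u) (hξ : ∀ c < n - 1 - k, ent ξ.1 (n - 1) c = 0) :
    ξ ∈ Submodule.span ℝ (gradH u '' Set.Icc 1 (n - 1)) := by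
  induction k generalizing ξ with
  | zero =>
    have : ξ = 0 := by
      ext1
      ext1 i c
      by_cases hic : i.val + 1 = n ∧ c.val + 1 < n
      · rw [← ent_val ξ.1, show i.val = n - 1 by omega, hξ _ (by omega)]
        rfl
      · exact ξ.2 i c hic
    rw [this]
    exact zero_mem _
  | succ k ih =>
    have hm : n - 1 - (k + 1) < n - 1 := by omega
    obtain ⟨r, hr⟩ := exists_algebraMap_of_dx_eq_zero _
      (dx_ent_eq_zero_of_J₁_eq_zero hn h hm hξ)
    have hj : n - 1 - (n - 1 - (k + 1)) = k + 1 := by omega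
    have hg := ent_gradH u hm
    rw [hj] at hg
    have hmem : gradH u (k + 1) ∈ kerJ₁ hn u :=
      (J₁_eq_zero_iff hn u _).2 (form₁_gradH hn u (by omega))
    -- The gradient with index `k + 1` has leading entry `1` exactly where `ξ` has its constant `r`,
    -- so the difference starts one place later.
    have h1 : ξ + (-r) • gradH u (k + 1) ∈ Submodule.span ℝ (gradH u '' Set.Icc 1 (n - 1)) := by
      refine ih (by omega) _ (add_mem h (Submodule.smul_mem _ _ hmem)) fun c hc => ?_
      have h2 : ent (ξ + (-r) • gradH u (k + 1)).1 (n - 1) c =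
          ent ξ.1 (n - 1) c + (-r) • ent (gradH u (k + 1)).1 (n - 1) c := by
        rw [ent_of_lt _ (by omega) (by omega), ent_of_lt _ (by omega) (by omega),
          ent_of_lt _ (by omega) (by omega)]
        rfl
      rw [h2, hg c (by omega)]
      split_ifs with hcm
      · rw [hcm, hr, Algebra.smul_def, mul_one, map_neg, add_neg_cancel]
      · rw [hξ c (by omega), smul_zero, add_zero]
    have h3 := Submodule.add_mem _ h1 (Submodule.smul_mem _ r
      (Submodule.subset_span ⟨k + 1, ⟨by omega, by omega⟩, rfl⟩))
    rwa [add_assoc, ← add_smul, neg_add_cancel, zero_smul, add_zero] at h3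

theorem gradH_image (hn : 2 ≤ n) (u : VLoop n) :
    (fun j : ℕ => gradient (H n j) u) '' Set.Icc 1 (n - 1) = gradH u '' Set.Icc 1 (n - 1) :=
  Set.image_congr fun j hj => gradient_H hn u (by have := hj.2; omega)

theorem J₁_gradient_H (hn : 2 ≤ n) (u : VLoop n) {j : ℕ} (hj : j ∈ Set.Icc 1 (n - 1)) :
    J₁ u (gradient (H n j) u) = 0 := by
  have := hj.2
  rw [gradient_H hn u (by omega), J₁_eq_zero_iff hn]
  exact form₁_gradH hn u (by omega)

end DSKdV

end

theorem mainTheorem8 (n : ℕ) (hn : 2 ≤ n) :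
    -- the objects are well defined
    (∀ u : DSKdV.VLoop n,
      ∃! p : Matrix (Fin n) (Fin n) (PowerSeries DSKdV.LoopRing) × (ℕ → DSKdV.LoopRing),
        DSKdV.IsDressing u p.1 p.2) ∧
    (∀ (u : DSKdV.VLoop n) (v : DSKdV.VtLoop n), ∃! C : DSKdV.LoopMat n, DSKdV.IsP u v C) ∧
    (∀ (u : DSKdV.VLoop n) (ξ : DSKdV.VtLoop n), ∃! w : DSKdV.VLoop n, DSKdV.IsJ₁ u ξ w) ∧
    (∀ j ∈ Set.Icc 1 (n - 1), ∀ u : DSKdV.VLoop n,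
      ∃! ξ : DSKdV.VtLoop n, DSKdV.IsGradient (DSKdV.H n j) u ξ) ∧
    -- the gradients of `H_1, …, H_{n-1}` are annihilated by the first Poisson operator
    (∀ j ∈ Set.Icc 1 (n - 1), ∀ u : DSKdV.VLoop n,
      DSKdV.J₁ u (DSKdV.gradient (DSKdV.H n j) u) = 0) ∧
    -- `H_1, …, H_{n-1}` are Casimirs of the first Poisson structure
    (∀ j ∈ Set.Icc 1 (n - 1), DSKdV.IsCasimir₁ (DSKdV.H n j)) ∧
    -- the kernel of the first Poisson operator is the span of the gradients
    (∀ u : DSKdV.VLoop n,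
      {ξ : DSKdV.VtLoop n | DSKdV.J₁ u ξ = 0} =
        (Submodule.span ℝ
          ((fun j : ℕ => DSKdV.gradient (DSKdV.H n j) u) '' Set.Icc 1 (n - 1)) :
            Set (DSKdV.VtLoop n))) := by
  refine ⟨DSKdV.existsUnique_isDressing hn, DSKdV.existsUnique_isP hn,
    DSKdV.existsUnique_isJ₁ hn, fun j hj u => DSKdV.existsUnique_isGradient_H hn u ?_,
    fun j hj u => DSKdV.J₁_gradient_H hn u hj, fun j hj F u _ => ?_, fun u => ?_⟩
  · have := hj.2
    omega
  · exact (DSKdV.J₁_eq_zero_iff hn u _).1 (DSKdV.J₁_gradient_H hn u hj) _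
  · refine Set.Subset.antisymm (fun ξ hξ => ?_) fun ξ hξ => ?_
    · rw [DSKdV.gradH_image hn]
      -- With `k = n - 1` the required initial zeros form an empty condition.
      exact DSKdV.mem_span_gradH hn u (n - 1) le_rfl ξ hξ fun c hc => by omega
    · have h : Submodule.span ℝ ((fun j : ℕ => DSKdV.gradient (DSKdV.H n j) u) ''
          Set.Icc 1 (n - 1)) ≤ DSKdV.kerJ₁ hn u := by
        rw [Submodule.span_le]
        rintro _ ⟨j, hj, rfl⟩
        exact DSKdV.J₁_gradient_H hn u hj
      exact h hξ
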